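/- **Quasitriviality Theorem.** Let $I\subset\mathbb R$ be open and let $c,p$ be smooth real functions on $I$; put $s=c\,c'''/3456$. Work with smooth functions of finitely many jet variables $u,u_x,u_{xx},\dots$ on the domain $u\in I$, $u_x\neq0$, with total derivative $\partial_x$ and variational derivative $\frac{\delta H}{\delta u(x)}=\sum_k(-1)^k\partial_x^k\frac{\partial h}{\partial u^{(k)}}$ of $H=\int h\,dx$; functionals are identified when their densities differ by a total $x$-derivative. The Poisson bracket is $\{u(x),u(y)\}=\delta'(x-y)$, so that $\{u(x),H\}=\partial_x\frac{\delta H}{\delta u(x)}$ and $\{F(x),H\}=\sum_k\frac{\partial F}{\partial u^{(k)}}\partial_x^k\{u(x),H\}$ for a function $F$ of the jet of $u$ at $x$. For smooth $f$ on $I$ let $H_f=\int h_f\,dx$, $$h_f=f-\frac{\epsilon^2}{24}c f'''u_x^2+\epsilon^4\Big[\Big(pf'''+\frac{c^2f^{(4)}}{480}\Big)u_{xx}^2-\Big(\frac{cc''f^{(4)}}{1152}+\frac{cc'f^{(5)}}{1152}+\frac{c^2f^{(6)}}{3456}+\frac{p'f^{(4)}}6+\frac{pf^{(5)}}6-sf'''\Big)u_x^4\Big],$$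 where all functions are evaluated at $u$. Let $$K=\int\Big[\frac{\epsilon}{24}\,c(u)\,u_x\log|u_x|+\epsilon^3\Big(\frac{c(u)^2}{5760}\frac{u_{xx}^3}{u_x^3}-\frac{p(u)}4\frac{u_{xx}^2}{u_x}\Big)\Big]dx .$$ 1. The canonical transformation generated by $K$, i.e. the formal power series in $\epsilon$ $$u\mapsto v=u+\epsilon\{u(x),K\}+\frac{\epsilon^2}2\{\{u(x),K\},K\}+\cdots,$$ satisfies $H_f=\int f(v)\,dx+O(\epsilon^6)$ for every smooth $f$ on $I$ (equality of the coefficients of $\epsilon^k$, $k<6$, as functionals). 2. The transformation $v\mapsto u$ generated in the same way by $-K$ is, modulo $O(\epsilon^6)$, the substitution, rational in the derivatives of $v$ and independent of $f$, $$\begin{aligned}u={}&v+\frac{\epsilon^2}{24}\partial_x\Big(c\frac{v_{xx}}{v_x}+c'v_x\Big)+\epsilon^4\partial_x\Big[c^2\,\partial_x\Big(\frac{v_{xx}^3}{360v_x^4}-\frac{7v_{xx}v_{xxx}}{1920v_x^3}+\frac{v_{xxxx}}{1152v_x^2}\Big)\\&+cc'\Big(\frac{47v_{xx}^3}{5760v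_x^3}-\frac{37v_{xx}v_{xxx}}{2880v_x^2}+\frac{5v_{xxxx}}{1152v_x}\Big)+c'^2\Big(\frac{v_{xxx}}{384}-\frac{v_{xx}^2}{5760v_x}\Big)+cc''\Big(\frac{v_{xxx}}{144}-\frac{v_{xx}^2}{360v_x}\Big)\\&+\frac1{1152}\big(7c'c''v_xv_{xx}+c''^2v_x^3+6cc'''v_xv_{xx}+c'c'''v_x^3+cc^{(4)}v_x^3\big)\\&+p\Big(\frac{v_{xx}^3}{2v_x^3}-\frac{v_{xx}v_{xxx}}{v_x^2}+\frac{v_{xxxx}}{2v_x}\Big)+p'v_{xxx}+\frac12p''v_xv_{xx}\Big],\qquad c=c(v),\ p=p(v).\end{aligned}$$ 3. The transformations in 1 and 2 are inverse to each other modulo $O(\epsilon^6)$: applying one and then the other to any smooth function $w$ on an open subset of $\mathbb R$ with values in $I$ and $w'\neq0$ gives $w+O(\epsilon^6)$ at each point. 4. Let $f$ be smooth on $I$, $a=f''$, and let $\Omega\subset\mathbb R^2$ be open. For every smooth solution $v:\Omega\to I$ of $v_s+a(v)v_x=0$ which is monotone in the sense that $v_x\ne0$ on $\Omega$, the function $u$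 given by the formula in 2 satisfies $$u_s+\partial_x\frac{\delta H_f}{\delta u(x)}=O(\epsilon^6).$$ The same holds for every family $v(\epsilon,x,s)$, smooth near $\{0\}\times\Omega$, with $v|_{\epsilon=0}\in I$ and $v_x|_{\epsilon=0}\neq0$ on $\Omega$, such that $v_s+a(v)v_x=O(\epsilon^6)$. Vice versa, if $u(\epsilon,x,s)$ is a family, smooth near $\{0\}\times\Omega$, with $u|_{\epsilon=0}\in I$ and $u_x|_{\epsilon=0}\ne0$ on $\Omega$, and $u_s+\partial_x\frac{\delta H_f}{\delta u(x)}=O(\epsilon^6)$, then the function $v$ obtained from $u$ by the transformation in 1, truncated modulo $O(\epsilon^6)$, satisfies $v_s+a(v)v_x=O(\epsilon^6)$. Here $O(\epsilon^6)$ is understood for $\epsilon\to0$ at each point of $\Omega$. -/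

import Mathlib

open Filter Topology Asymptotics Set
open scoped ContDiff Nat

noncomputable section

namespace Quasitriviality

/-! ### Formal calculus of variations in one dependent variable

A jet is a sequence `z`, where `z k` stands for the `k`-th `x`-derivative of `u`. -/

/-- Infinite jets `(u, u_x, u_xx, …)`. -/
abbrev Jet : Type := ℕ → ℝ

/-- Functions of the jet variables. -/
abbrev JetFun : Type := Jet → ℝ

/-- The jet variable `u^{(k)}`. -/
def coord (k : ℕ) : JetFun := fun z => z k

/-- The partial derivative `∂h/∂u^{(k)}`. -/
def pderiv (k : ℕ) (h : JetFun) : JetFun :=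
  fun z => deriv (fun t => h (Function.update z k t)) (z k)

/-- The total derivative `∂_x h = ∑ₖ u^{(k+1)} ∂h/∂u^{(k)}`
(a finite sum if `h` depends on finitely many jet variables). -/
def totalD (h : JetFun) : JetFun :=
  fun z => ∑ᶠ k : ℕ, z (k + 1) * pderiv k h z

/-- The Euler–Lagrange operator `∑ₖ (-1)ᵏ ∂_xᵏ ∂h/∂u^{(k)}`, i.e. the variational derivative
`δH/δu(x)` of `H = ∫ h dx`. -/
def euler (h : JetFun) : JetFun :=
  fun z => ∑ᶠ k : ℕ, (-1 : ℝ) ^ k * (totalD^[k] (pderiv k h)) z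

/-- The derivative `∑ₖ (∂_xᵏ w) ∂g/∂u^{(k)}` of `g` along the evolutionary field `u ↦ w`. -/
def evol (w g : JetFun) : JetFun :=
  fun z => ∑ᶠ k : ℕ, (totalD^[k] w) z * pderiv k g z

/-- The domain `u ∈ I`, `u_x ≠ 0` of the jet space. -/
def Dom (I : Set ℝ) : Set Jet := {z | z 0 ∈ I ∧ z 1 ≠ 0}

/-- On `Dom I` the function `g` is a smooth function of finitely many jet variables. -/
def IsLocal (I : Set ℝ) (g : JetFun) : Prop :=
  ∃ (N : ℕ) (G : (Fin (N + 2) → ℝ) → ℝ),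
    ContDiffOn ℝ ∞ G {y | y 0 ∈ I ∧ y 1 ≠ 0} ∧ ∀ z ∈ Dom I, g z = G (fun i => z i)

/-- Equality `∫ h₁ dx = ∫ h₂ dx` of local functionals: the densities differ by the total
`x`-derivative of a local function. -/
def SameFunctional (I : Set ℝ) (h₁ h₂ : JetFun) : Prop :=
  ∃ g : JetFun, IsLocal I g ∧ ∀ z ∈ Dom I, h₁ z - h₂ z = totalD g z

/-! ### Formal power series in `ε` -/

/-- Formal power series in `ε` whose coefficients are functions of the jet variables. -/
abbrev EpsFun : Type := PowerSeries JetFun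

/-- `{u(x), H} = ∂_x δH/δu(x)` for `H = ∫ h dx` and `{u(x), u(y)} = δ'(x - y)`. -/
def hamField (h : EpsFun) : EpsFun :=
  PowerSeries.mk fun n => totalD (euler (PowerSeries.coeff n h))

/-- The bracket `{F(x), K} = ∑ₖ ∂F/∂u^{(k)} ∂_xᵏ {u(x), K}` of a function `F` of the jet of `u` at `x`
with the functional `K` of density `κ`, extended to power series in `ε`. -/
def bracket (F κ : EpsFun) : EpsFun :=
  PowerSeries.mk fun n => ∑ q ∈ Finset.HasAntidiagonal.antidiagonal n,
    evol (PowerSeries.coeff q.1 (hamField κ)) (PowerSeries.coeff q.2 F)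

/-- The canonical transformation generated by `K = ∫ κ dx`,
`u + ε {u(x), K} + (ε² / 2!) {{u(x), K}, K} + (ε³ / 3!) {{{u(x), K}, K}, K} + …`
(terms with more than `n` brackets do not contribute to the coefficient of `εⁿ`). -/
def canonical (κ : EpsFun) : EpsFun :=
  PowerSeries.mk fun n => ∑ m ∈ Finset.range (n + 1),
    ((m ! : ℝ)⁻¹) • PowerSeries.coeff n
      (PowerSeries.X ^ m * (fun F => bracket F κ)^[m] (PowerSeries.C (coord 0)))

/-- `f(V)` for a power series `V = u + O(ε)`, as its Taylor series
`∑ⱼ f^{(j)}(u) (V - u)ʲ / j!`. -/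
def applyFun (f : ℝ → ℝ) (V : EpsFun) : EpsFun :=
  PowerSeries.mk fun n => fun z => ∑ j ∈ Finset.range (n + 1),
    iteratedDeriv j f (z 0) / (j ! : ℝ) *
      PowerSeries.coeff n ((V - PowerSeries.C (coord 0)) ^ j) z

/-! ### The Hamiltonians and the explicit substitution -/

/-- The density of `K`:
`ε c u_x log u_x / 24 + ε³ (c² u_xx³ / (5760 u_x³) - p u_xx² / (4 u_x))`.
Here `Real.log u_x` is `log |u_x|`. -/
def densityK (c p : ℝ → ℝ) : EpsFun :=
  PowerSeries.monomial 1 (fun z : Jet => 1 / 24 * c (z 0) * z 1 * Real.log (z 1)) +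
  PowerSeries.monomial 3 (fun z : Jet =>
    c (z 0) ^ 2 / 5760 * (z 2 ^ 3 / z 1 ^ 3) - p (z 0) / 4 * (z 2 ^ 2 / z 1))

/-- The density `h_f` of the perturbed Hamiltonian `H_f` with functional parameters `c, p, s`. -/
def densityH (c p s f : ℝ → ℝ) : EpsFun :=
  PowerSeries.monomial 0 (fun z : Jet => f (z 0)) +
  PowerSeries.monomial 2 (fun z : Jet => -(1 / 24) * c (z 0) * iteratedDeriv 3 f (z 0) * z 1 ^ 2) +
  PowerSeries.monomial 4 (fun z : Jet =>
    (p (z 0) * iteratedDeriv 3 f (z 0) + c (z 0) ^ 2 * iteratedDeriv 4 f (z 0) / 480) * z 2 ^ 2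
    - (c (z 0) * iteratedDeriv 2 c (z 0) * iteratedDeriv 4 f (z 0) / 1152
      + c (z 0) * iteratedDeriv 1 c (z 0) * iteratedDeriv 5 f (z 0) / 1152
      + c (z 0) ^ 2 * iteratedDeriv 6 f (z 0) / 3456
      + iteratedDeriv 1 p (z 0) * iteratedDeriv 4 f (z 0) / 6
      + p (z 0) * iteratedDeriv 5 f (z 0) / 6
      - s (z 0) * iteratedDeriv 3 f (z 0)) * z 1 ^ 4)

/-- The choice `s = c c''' / 3456`. -/
def sFun (c : ℝ → ℝ) : ℝ → ℝ := fun u => c u * iteratedDeriv 3 c u / 3456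

/-- The expression in square brackets, under `∂_x`, in the `ε⁴`-term of the substitution. -/
def quasiBracket (c p : ℝ → ℝ) : JetFun := fun z =>
  c (z 0) ^ 2 * totalD (fun y : Jet =>
      y 2 ^ 3 / (360 * y 1 ^ 4) - 7 * y 2 * y 3 / (1920 * y 1 ^ 3) + y 4 / (1152 * y 1 ^ 2)) z
  + c (z 0) * iteratedDeriv 1 c (z 0) *
      (47 * z 2 ^ 3 / (5760 * z 1 ^ 3) - 37 * z 2 * z 3 / (2880 * z 1 ^ 2)
        + 5 * z 4 / (1152 * z 1))
  + iteratedDeriv 1 c (z 0) ^ 2 * (z 3 / 384 - z 2 ^ 2 / (5760 * z 1))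
  + c (z 0) * iteratedDeriv 2 c (z 0) * (z 3 / 144 - z 2 ^ 2 / (360 * z 1))
  + 1 / 1152 * (7 * iteratedDeriv 1 c (z 0) * iteratedDeriv 2 c (z 0) * z 1 * z 2
      + iteratedDeriv 2 c (z 0) ^ 2 * z 1 ^ 3
      + 6 * c (z 0) * iteratedDeriv 3 c (z 0) * z 1 * z 2
      + iteratedDeriv 1 c (z 0) * iteratedDeriv 3 c (z 0) * z 1 ^ 3
      + c (z 0) * iteratedDeriv 4 c (z 0) * z 1 ^ 3)
  + p (z 0) * (z 2 ^ 3 / (2 * z 1 ^ 3) - z 2 * z 3 / z 1 ^ 2 + z 4 / (2 * z 1))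
  + iteratedDeriv 1 p (z 0) * z 3
  + iteratedDeriv 2 p (z 0) * (z 1 * z 2 / 2)

/-- The explicit substitution `v ↦ u = v + (ε²/24) ∂_x (c v_xx / v_x + c' v_x) + ε⁴ ∂_x [ … ]`,
which is rational in the derivatives of `v`. -/
def quasi (c p : ℝ → ℝ) : EpsFun :=
  PowerSeries.monomial 0 (coord 0) +
  PowerSeries.monomial 2 (fun z : Jet => 1 / 24 *
    totalD (fun y : Jet => c (y 0) * (y 2 / y 1) + iteratedDeriv 1 c (y 0) * y 1) z) +
  PowerSeries.monomial 4 (totalD (quasiBracket c p))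

/-! ### Substitutions and solutions modulo `O(ε⁶)` -/

/-- The jet `(w(x), w'(x), w''(x), …)` of a function at a point. -/
def jet (w : ℝ → ℝ) (x : ℝ) : Jet := fun k => iteratedDeriv k w x

/-- The value of a power series in `ε`, modulo `O(ε⁶)`, at a number `ε` and a jet. -/
def eval6 (F : EpsFun) (ε : ℝ) (z : Jet) : ℝ :=
  ∑ k ∈ Finset.range 6, ε ^ k * PowerSeries.coeff k F z

/-- The substitution `F`, modulo `O(ε⁶)`, applied to a family `w = w(ε, x, s)`:
`(ε, x, s) ↦ F(w, w_x, w_xx, …; ε)`. -/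
def substitute (F : EpsFun) (w : ℝ → ℝ → ℝ → ℝ) : ℝ → ℝ → ℝ → ℝ :=
  fun ε x s => eval6 F ε (jet (fun y => w ε y s) x)

/-- A family `w = w(ε, x, s)`, smooth in all variables near `{0} × Ω`, with values in `I` and
monotone in `x` for `ε = 0`. -/
def IsMonotoneFamily (I : Set ℝ) (Ω : Set (ℝ × ℝ)) (w : ℝ → ℝ → ℝ → ℝ) : Prop :=
  (∃ U : Set (ℝ × ℝ × ℝ), IsOpen U ∧ (∀ q ∈ Ω, ((0 : ℝ), q) ∈ U) ∧
    ContDiffOn ℝ ∞ (fun r : ℝ × ℝ × ℝ => w r.1 r.2.1 r.2.2) U) ∧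
  ∀ x s, (x, s) ∈ Ω → w 0 x s ∈ I ∧ deriv (fun y => w 0 y s) x ≠ 0

/-- `v_s + a(v) v_x = O(ε⁶)` at all points of `Ω`, for a family `v = v(ε, x, s)`. -/
def SolvesUnperturbed (a : ℝ → ℝ) (Ω : Set (ℝ × ℝ)) (v : ℝ → ℝ → ℝ → ℝ) : Prop :=
  ∀ x s, (x, s) ∈ Ω →
    (fun ε => deriv (fun σ => v ε x σ) s + a (v ε x s) * deriv (fun y => v ε y s) x)
      =O[𝓝 0] fun ε : ℝ => ε ^ 6

/-- `u_s + ∂_x δH/δu(x) = O(ε⁶)` at all points of `Ω`, for a family `u = u(ε, x, s)` and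
`H = ∫ h dx`. -/
def SolvesHamiltonian (h : EpsFun) (Ω : Set (ℝ × ℝ)) (u : ℝ → ℝ → ℝ → ℝ) : Prop :=
  ∀ x s, (x, s) ∈ Ω →
    (fun ε => deriv (fun σ => u ε x σ) s + eval6 (hamField h) ε (jet (fun y => u ε y s) x))
      =O[𝓝 0] fun ε : ℝ => ε ^ 6

end Quasitriviality

end

open Quasitriviality

noncomputable section

namespace Quasitriviality

/-! ### Differential polynomials

A computable model of the local functions that are polynomial in `u_xx, u_xxx, …`, `log |u_x|` and
the derivatives of finitely many functions of `u`, and Laurent polynomial in `u_x`. -/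

/-! Let X₁, X₃ be the fields ∂_x δ/δu of the two coefficients of K. Since K has only the orders ε
and ε³, the m-fold bracket, with its extra factor ε^m, contributes only to even orders from ε^{2m}
on. Modulo O(ε⁶) the canonical transformation is therefore u + ε² X₁ + ε⁴ (X₃ + ½ X₁·X₁), where
X₁·X₁ is the derivative of X₁ along itself (`isEvenExpansion_canonical`). The logarithm in K
disappears under δ/δu: that of c u_x log|u_x| is -(c u_xx/u_x + c' u_x). So both transformations are
rational in the derivatives.

Each assertion thus reduces to finitely many identities, at the orders ε² and ε⁴, between
expressions in u_x^{±1}, log|u_x|, the higher u^{(k)} and the derivatives of c, p, f. These are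
regarded as independent symbols, and each identity is proved by computing in a normal form
(`same_densityH₄`, `same_quasi₄`, `same_inverse₄`, `same_solves₄` and their companions). The lemmas
`Represents.euler`, `Represents.totalD` and `Represents.evol` show that the computed operators agree
on `Dom I` with the analytic ones.

The identities for H_f exhibit h_f minus the density of f(v) as the total derivative of an explicit
local function. Those for inverses say that exp(K) and exp(-K) cancel up to ε⁴. Those for solutions
say that the transformation intertwines the flows of H_f and ∫f.

The passage from formal identities to functions needs two analytic facts. First, the derivatives of
a substituted function are given by the prolongation (`jet_substitution`), and a Taylor formula with
uniform remainder at a jet moving with ε (`isBigO_eval_sub_taylor`) controls compositions. Second,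
if an equation holds up to O(ε⁶) at each point of the open set Ω, so do all its x-derivatives: for
functions smooth near {0} × Ω the estimate means that the ε-derivatives of order < 6 vanish at ε =
0, a condition that can be differentiated along Ω (`isBigO_pdir`). Together they give
`substitution_inverse` and `substitution_solves`. -/

/-- A term `(q, e, l)` stands for `q u_x ^ e ∏_{n ∈ l} g_n`, where the generator `g_n` is
`u^{(k + 2)}` for `n = 5 k`, `log |u_x|` for `n ≡ 4`, and `F_i^{(j)}(u)` for `n = 5 j + i`,
`i = 1, 2, 3`. The lists of generators are decreasing, and the terms of a polynomial are
increasing with respect to `cmpMono`. -/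
abbrev DiffPoly : Type := List (ℚ × ℤ × List ℕ)

namespace DiffPoly

/-- Lexicographic comparison. Here and below recursors are written out for the sake of a fast
evaluation by the kernel. -/
def cmpGens (l : List ℕ) : List ℕ → Ordering :=
  l.rec (fun m => m.rec .eq fun _ _ _ => .lt) fun a _ cmp m => m.rec .gt fun b m' _ =>
    (Nat.ble a b).rec .gt ((Nat.ble b a).rec .lt (cmp m'))

/-- The comparison of monomials. -/
def cmpMono (a b : ℤ × List ℕ) : Ordering :=
  (cmpGens a.2 b.2).rec .lt
    (if a.1 = b.1 then .eq else if a.1 < b.1 then .lt else .gt) .gt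

/-- An auxiliary function for `add`. -/
def addCons (t : ℚ × ℤ × List ℕ) (P : DiffPoly) (addP : DiffPoly → DiffPoly) (Q : DiffPoly) :
    DiffPoly :=
  Q.rec (t :: P) fun s Q ih => (cmpMono t.2 s.2).rec (t :: addP (s :: Q))
    (if t.1 + s.1 = 0 then addP Q else (t.1 + s.1, t.2) :: addP Q) (s :: ih)

/-- The sum of two differential polynomials. -/
def add (P : DiffPoly) : DiffPoly → DiffPoly :=
  P.rec (fun Q => Q) fun t P addP Q => addCons t P addP Q

/-- Sums of adjacent pairs. -/
def addPairs : List DiffPoly → List DiffPoly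
  | P :: Q :: L => add P Q :: addPairs L
  | L => L

/-- The sum of a list of differential polynomials, by bisection up to the depth `n`. -/
def sum : ℕ → List DiffPoly → DiffPoly
  | 0, L => L.foldr add []
  | _ + 1, [] => []
  | _ + 1, [P] => P
  | n + 1, L => sum n (addPairs L)

/-- Insertion into a decreasing list. -/
def insertGen (a : ℕ) (l : List ℕ) : List ℕ :=
  l.rec [a] fun b l ins => (Nat.ble b a).rec (b :: ins) (a :: b :: l)

/-- The product of two monomials in the generators. -/
def mulGens (l m : List ℕ) : List ℕ := l.foldr insertGen m

/-- The product of a term and a differential polynomial. -/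
def mulTerm (t : ℚ × ℤ × List ℕ) (P : DiffPoly) : DiffPoly :=
  if t.1 = 0 then [] else P.map fun s => (t.1 * s.1, t.2.1 + s.2.1, mulGens t.2.2 s.2.2)

/-- The product of two differential polynomials. -/
def mul (P Q : DiffPoly) : DiffPoly := sum 12 (P.map fun t => mulTerm t Q)

/-- The derivation with given values on the generators, on monomials in the generators. -/
def derGens (d : ℕ → DiffPoly) : List ℕ → DiffPoly
  | [] => []
  | a :: l => add (mulTerm (1, 0, l) (d a)) (mulTerm (1, 0, [a]) (derGens d l))

/-- The derivation with the value `ψ` on `u_x` and given values on the generators. -/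
def der (ψ : DiffPoly) (d : ℕ → DiffPoly) (P : DiffPoly) : DiffPoly :=
  sum 12 (P.map fun t =>
    add (mulTerm (t.1 * t.2.1, t.2.1 - 1, t.2.2) ψ) (mulTerm (t.1, t.2.1, []) (derGens d t.2.2)))

/-- The derivation along a vector field, given the components of its prolongation. -/
def along (w : ℕ → DiffPoly) : DiffPoly → DiffPoly :=
  der (w 1) fun n => if n % 5 = 0 then w (n / 5 + 2) else
    if n % 5 = 4 then mulTerm (1, -1, []) (w 1) else mulTerm (1, 0, [n + 5]) (w 0)

/-- The constant `q`. -/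
def const (q : ℚ) : DiffPoly := if q = 0 then [] else [(q, 0, [])]

/-- The jet variable `u^{(k)}` for `k > 0`. -/
def var : ℕ → DiffPoly
  | k + 2 => [(1, 0, [5 * k])]
  | _ => [(1, 1, [])]

/-- The function `F_i^{(j)}(u)`. -/
def fn (i j : ℕ) : DiffPoly := [(1, 0, [5 * j + i])]

/-- The partial derivative with respect to `u^{(k)}`. -/
def pd (k : ℕ) : DiffPoly → DiffPoly := along fun j => if j = k then const 1 else []

/-- The total derivative. -/
def total : DiffPoly → DiffPoly := along fun k => var (k + 1)

/-- The derivative along the evolutionary field `u ↦ w`. -/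
def ev (w : DiffPoly) : DiffPoly → DiffPoly := along fun k => total^[k] w

/-- A bound of the orders of the jet variables that occur in a monomial. -/
def ordGens : List ℕ → ℕ
  | [] => 2
  | a :: l => max (a / 5 + 3) (ordGens l)

/-- A bound of the orders of the jet variables that occur. -/
def ord : DiffPoly → ℕ
  | [] => 2
  | t :: P => max (ordGens t.2.2) (ord P)

/-- The Euler–Lagrange operator. -/
def eulerLagrange (P : DiffPoly) : DiffPoly :=
  sum 4 ((List.range P.ord).map fun k => mulTerm ((-1) ^ k, 0, []) (total^[k] (pd k P)))

/-- Multiplication by a constant. -/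
def smul (q : ℚ) (P : DiffPoly) : DiffPoly := mulTerm (q, 0, []) P

/-- Whether the difference of two differential polynomials reduces to zero. -/
def same (P Q : DiffPoly) : Bool := (add P (smul (-1) Q)).isEmpty

end DiffPoly

namespace DiffPoly

/-! ### Values of differential polynomials -/

/-- The value of a generator. -/
def gen (F : ℕ → ℝ → ℝ) (z : Jet) (n : ℕ) : ℝ :=
  if n % 5 = 0 then z (n / 5 + 2) else
    if n % 5 = 4 then Real.log (z 1) else iteratedDeriv (n / 5) (F (n % 5)) (z 0)

/-- The value of a monomial in the generators. -/
def mon (F : ℕ → ℝ → ℝ) (z : Jet) (l : List ℕ) : ℝ := (l.map (gen F z)).prod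

/-- The value of a differential polynomial. -/
def eval (F : ℕ → ℝ → ℝ) (P : DiffPoly) : JetFun := fun z =>
  (P.map fun t => (t.1 : ℝ) * (z 1 ^ t.2.1 * mon F z t.2.2)).sum

/-- The derivative of a generator at `z` in the direction `h`. -/
def dgen (F : ℕ → ℝ → ℝ) (z h : Jet) (n : ℕ) : ℝ :=
  if n % 5 = 0 then h (n / 5 + 2) else
    if n % 5 = 4 then h 1 / z 1 else iteratedDeriv (n / 5 + 1) (F (n % 5)) (z 0) * h 0

/-- The derivative of a monomial in the generators. -/
def dmon (F : ℕ → ℝ → ℝ) (z h : Jet) : List ℕ → ℝ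
  | [] => 0
  | a :: l => mon F z l * dgen F z h a + gen F z a * dmon F z h l

/-- The derivative of a differential polynomial at `z` in the direction `h`. -/
def deval (F : ℕ → ℝ → ℝ) (P : DiffPoly) (z h : Jet) : ℝ :=
  (P.map fun t => (t.1 : ℝ) *
    (t.2.1 * z 1 ^ (t.2.1 - 1) * h 1 * mon F z t.2.2 + z 1 ^ t.2.1 * dmon F z h t.2.2)).sum

variable {F : ℕ → ℝ → ℝ} {z h h' : Jet}

@[simp] lemma mon_nil : mon F z [] = 1 := rfl

@[simp] lemma mon_cons (a : ℕ) (l : List ℕ) : mon F z (a :: l) = gen F z a * mon F z l := by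
  simp [mon]

@[simp] lemma eval_nil : eval F [] z = 0 := rfl

@[simp] lemma eval_cons (t : ℚ × ℤ × List ℕ) (P : DiffPoly) :
    eval F (t :: P) z = t.1 * (z 1 ^ t.2.1 * mon F z t.2.2) + eval F P z := by simp [eval]

@[simp] lemma deval_nil : deval F [] z h = 0 := rfl

@[simp] lemma deval_cons (t : ℚ × ℤ × List ℕ) (P : DiffPoly) :
    deval F (t :: P) z h = t.1 * (t.2.1 * z 1 ^ (t.2.1 - 1) * h 1 * mon F z t.2.2
      + z 1 ^ t.2.1 * dmon F z h t.2.2) + deval F P z h := by simp [deval]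

/-- Soundness of merging needs only that `.eq` implies equality. That lists stay sorted affects
whether a computation reaches the empty list, never the truth of its result, so no invariant of
sortedness is proved. -/
lemma eq_of_cmpGens : ∀ {l m : List ℕ}, cmpGens l m = .eq → l = m
  | [], [], _ => rfl
  | [], _ :: _, H => by simp [cmpGens] at H
  | _ :: _, [], H => by simp [cmpGens] at H
  | a :: l, b :: m, H => by
    change (Nat.ble a b).rec .gt ((Nat.ble b a).rec .lt (cmpGens l m)) = Ordering.eq at H
    rcases h1 : Nat.ble a b <;> rcases h2 : Nat.ble b a <;> simp only [h1, h2] at H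
    · cases H
    · cases H
    · cases H
    · rw [eq_of_cmpGens H, le_antisymm (Nat.le_of_ble_eq_true h1) (Nat.le_of_ble_eq_true h2)]

lemma eq_of_cmpMono {a b : ℤ × List ℕ} (H : cmpMono a b = .eq) : a = b := by
  unfold cmpMono at H
  rcases h1 : cmpGens a.2 b.2 <;> simp only [h1] at H
  · cases H
  · refine Prod.ext ?_ (eq_of_cmpGens h1)
    by_contra hne
    rw [if_neg hne] at H
    split_ifs at H
  · cases H

lemma eval_addCons {t : ℚ × ℤ × List ℕ} {P : DiffPoly} {addP : DiffPoly → DiffPoly}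
    (H : ∀ Q, eval F (addP Q) z = eval F P z + eval F Q z) :
    ∀ Q, eval F (addCons t P addP Q) z = eval F (t :: P) z + eval F Q z
  | [] => by simp [addCons]
  | s :: Q => by
    have ih := eval_addCons (t := t) H Q
    change eval F ((cmpMono t.2 s.2).rec (t :: addP (s :: Q))
      (if t.1 + s.1 = 0 then addP Q else (t.1 + s.1, t.2) :: addP Q)
      (s :: addCons t P addP Q)) z = _
    rcases h1 : cmpMono t.2 s.2
    · simp only [eval_cons, H]; ring
    · have h2 := eq_of_cmpMono h1
      have h3 : eval F (t :: P) z + eval F (s :: Q) z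
          = ((t.1 + s.1 : ℚ) : ℝ) * (z 1 ^ t.2.1 * mon F z t.2.2)
            + (eval F P z + eval F Q z) := by
        simp only [eval_cons, h2]; push_cast; ring
      rw [h3]
      dsimp only
      split_ifs with h4
      · rw [h4, H]; simp
      · rw [eval_cons, H]
    · simp only [eval_cons, ih]; ring

@[simp] lemma eval_add : ∀ P Q : DiffPoly, eval F (add P Q) z = eval F P z + eval F Q z
  | [], Q => by simp [add]
  | _ :: P, Q => eval_addCons (eval_add P) Q

lemma eval_addPairs : ∀ L : List DiffPoly,
    ((addPairs L).map fun P => eval F P z).sum = (L.map fun P => eval F P z).sum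
  | [] => rfl
  | [_] => rfl
  | P :: Q :: L => by simp [addPairs, eval_addPairs L, add_assoc]

-- The depth is irrelevant to the value: whatever remains at depth 0 is added up by a fold.
@[simp] lemma eval_sum : ∀ (n : ℕ) (L : List DiffPoly),
    eval F (sum n L) z = (L.map fun P => eval F P z).sum
  | 0, L => by
    induction L with
    | nil => rfl
    | cons P L ih => simpa [sum] using ih
  | _ + 1, [] => rfl
  | _ + 1, [P] => by simp [sum]
  | n + 1, P :: Q :: L => by
    rw [sum, eval_sum n, eval_addPairs]
    · simp
    · simp

@[simp] lemma mon_insertGen (a : ℕ) : ∀ l, mon F z (insertGen a l) = gen F z a * mon F z l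
  | [] => by simp [insertGen]
  | b :: l => by
    change mon F z ((Nat.ble b a).rec (b :: insertGen a l) (a :: b :: l)) = _
    rcases Nat.ble b a
    · simp only [mon_cons, mon_insertGen a l]; ring
    · simp

@[simp] lemma mon_mulGens (l m : List ℕ) : mon F z (mulGens l m) = mon F z l * mon F z m := by
  induction l with
  | nil => simp [mulGens]
  | cons a l ih =>
    rw [mon_cons, mul_assoc, ← ih]
    simp [mulGens]

lemma eval_mulTerm (hz : z 1 ≠ 0) (t : ℚ × ℤ × List ℕ) (P : DiffPoly) :
    eval F (mulTerm t P) z = t.1 * (z 1 ^ t.2.1 * mon F z t.2.2) * eval F P z := by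
  unfold mulTerm
  split_ifs with h0
  · simp [h0]
  · induction P with
    | nil => simp
    | cons s P ih =>
      simp only [List.map_cons, eval_cons, ih, mon_mulGens, zpow_add₀ hz]
      push_cast
      ring

@[simp] lemma eval_smul (hz : z 1 ≠ 0) (q : ℚ) (P : DiffPoly) :
    eval F (smul q P) z = q * eval F P z := by simp [smul, eval_mulTerm hz]

@[simp] lemma eval_mul (hz : z 1 ≠ 0) (P Q : DiffPoly) :
    eval F (mul P Q) z = eval F P z * eval F Q z := by
  rw [mul, eval_sum]
  induction P with
  | nil => simp
  | cons t P ih => simp only [List.map_cons, List.sum_cons, ih, eval_mulTerm hz, eval_cons]; ring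

@[simp] lemma eval_const (q : ℚ) : eval F (const q) z = q := by
  unfold const
  split_ifs with h0 <;> simp [h0]

@[simp] lemma eval_var_succ (k : ℕ) : eval F (var (k + 1)) z = z (k + 1) := by
  cases k <;> simp [var, gen]

lemma eval_fn {i : ℕ} (hi : i % 5 ≠ 0 ∧ i % 5 ≠ 4) (j : ℕ) :
    eval F (fn i j) z = iteratedDeriv (j + i / 5) (F (i % 5)) (z 0) := by
  have h1 : (5 * j + i) % 5 = i % 5 := by omega
  have h2 : (5 * j + i) / 5 = j + i / 5 := by omega
  simp [fn, gen, h1, h2, hi]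

lemma eval_eq_of_same (hz : z 1 ≠ 0) {P Q : DiffPoly} (H : same P Q = true) :
    eval F P z = eval F Q z := by
  have h1 : eval F (add P (smul (-1) Q)) z = 0 := by
    rw [same, List.isEmpty_iff] at H
    rw [H, eval_nil]
  rw [eval_add, eval_smul hz] at h1
  push_cast at h1
  linarith

/-! ### Derivations -/

lemma eval_der (hz : z 1 ≠ 0) {ψ : DiffPoly} {d : ℕ → DiffPoly} (hψ : eval F ψ z = h 1)
    (hd : ∀ n, eval F (d n) z = dgen F z h n) (P : DiffPoly) :
    eval F (der ψ d P) z = deval F P z h := by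
  have h1 : ∀ l, eval F (derGens d l) z = dmon F z h l := by
    intro l
    induction l with
    | nil => rfl
    | cons a l ih => simp [derGens, dmon, eval_mulTerm hz, ih, hd]
  rw [der, eval_sum]
  induction P with
  | nil => simp
  | cons t P ih =>
    simp only [List.map_cons, List.sum_cons, ih, eval_add, eval_mulTerm hz, deval_cons, h1, hψ,
      mon_nil]
    push_cast
    ring

/-- Partial, total and evolutionary derivatives are one and the same directional derivative, in the
directions e_k, (z_{k+1})_k and (∂_x^k w)_k. Hence one chain rule serves all three. -/
lemma eval_along (hz : z 1 ≠ 0) {w : ℕ → DiffPoly} (hw : ∀ k, eval F (w k) z = h k)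
    (P : DiffPoly) : eval F (along w P) z = deval F P z h := by
  refine eval_der hz (hw 1) (fun n => ?_) P
  unfold dgen
  split_ifs with h1 h2
  · exact hw _
  · rw [eval_mulTerm hz, hw]
    simp [div_eq_inv_mul]
  -- Adding 5 to the index of a coefficient function keeps its residue and raises its order of
  -- differentiation by one.
  · have h3 : (n + 5) % 5 = n % 5 := by omega
    have h4 : (n + 5) / 5 = n / 5 + 1 := by omega
    simp [eval_mulTerm hz, hw, gen, h1, h2, h4]

lemma eval_pd (hz : z 1 ≠ 0) (k : ℕ) (P : DiffPoly) :
    eval F (pd k P) z = deval F P z (Pi.single k 1) :=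
  eval_along hz (fun j => by by_cases hj : j = k <;> simp [hj]) P

lemma eval_total (hz : z 1 ≠ 0) (P : DiffPoly) :
    eval F (total P) z = deval F P z (fun k => z (k + 1)) :=
  eval_along hz (fun k => eval_var_succ k) P

lemma eval_ev (hz : z 1 ≠ 0) (w P : DiffPoly) :
    eval F (ev w P) z = deval F P z (fun k => eval F (total^[k] w) z) :=
  eval_along hz (fun _ => rfl) P

/-- The bound starts at 2 because u and u_x may enter through coefficient functions, logarithms and
powers. For these generators the summand `a / 5 + 3` is an overestimate, which does no harm. -/
lemma dmon_congr : ∀ (l : List ℕ), (∀ k < ordGens l, h k = h' k) → dmon F z h l = dmon F z h' l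
  | [], _ => rfl
  | a :: l, H => by
    have h2 : 2 ≤ ordGens l := by
      clear H
      induction l with
      | nil => exact le_rfl
      | cons b l ih => exact ih.trans (le_max_right _ _)
    rw [dmon, dmon, dmon_congr l fun k hk => H k (lt_max_of_lt_right hk)]
    have h1 : dgen F z h a = dgen F z h' a := by
      unfold dgen
      rw [H (a / 5 + 2) (lt_max_of_lt_left (by omega)), H 0 (lt_max_of_lt_right (by omega)),
        H 1 (lt_max_of_lt_right (by omega))]
    rw [h1]

lemma two_le_ord (P : DiffPoly) : 2 ≤ ord P := by
  induction P with
  | nil => exact le_rfl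
  | cons b l ih => exact ih.trans (le_max_right _ _)

lemma deval_congr : ∀ (P : DiffPoly), (∀ k < ord P, h k = h' k) → deval F P z h = deval F P z h'
  | [], _ => rfl
  | t :: P, H => by
    rw [deval_cons, deval_cons, deval_congr P fun k hk => H k (lt_max_of_lt_right hk),
      dmon_congr t.2.2 fun k hk => H k (lt_max_of_lt_left hk),
      H 1 (lt_max_of_lt_right (two_le_ord P))]

lemma dmon_add_smul (a : ℝ) : ∀ l : List ℕ,
    dmon F z (h + a • h') l = dmon F z h l + a * dmon F z h' l
  | [] => by simp [dmon]
  | b :: l => by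
    have h1 : dgen F z (h + a • h') b = dgen F z h b + a * dgen F z h' b := by
      unfold dgen
      split_ifs <;> simp <;> ring
    rw [dmon, dmon, dmon, dmon_add_smul a l, h1]
    ring

lemma deval_add_smul (P : DiffPoly) (h h' : Jet) (a : ℝ) :
    deval F P z (h + a • h') = deval F P z h + a * deval F P z h' := by
  induction P with
  | nil => simp
  | cons t P ih =>
    simp only [deval_cons, ih, dmon_add_smul, Pi.add_apply, Pi.smul_apply, smul_eq_mul]
    ring

lemma deval_zero (P : DiffPoly) : deval F P z 0 = 0 := by
  have := deval_add_smul (F := F) (z := z) P 0 0 1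
  rw [one_smul, add_zero] at this
  linarith

/-- Linearity in the direction, together with dependence on finitely many of its components. This is
what makes the formally infinite sums over jet variables finite. -/
lemma deval_eq_sum (P : DiffPoly) {N : ℕ} (hN : ord P ≤ N) (z h : Jet) :
    deval F P z h = ∑ k ∈ Finset.range N, h k * deval F P z (Pi.single k 1) := by
  have h1 : deval F P z h = deval F P z (∑ k ∈ Finset.range N, h k • Pi.single k (1 : ℝ)) := by
    refine deval_congr P fun k hk => ?_
    simp [Finset.sum_apply, Pi.single_apply, hk.trans_le hN]
  rw [h1]
  clear h1 hN
  induction N with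
  | zero => simp [deval_zero]
  | succ N ih => rw [Finset.sum_range_succ, Finset.sum_range_succ, deval_add_smul, ih]

lemma mon_congr {z' : Jet} (h0 : z 0 = z' 0) (h1 : z 1 = z' 1) : ∀ (l : List ℕ),
    (∀ k < ordGens l, z k = z' k) → mon F z l = mon F z' l
  | [], _ => rfl
  | a :: l, H => by
    rw [mon_cons, mon_cons, mon_congr h0 h1 l fun k hk => H k (lt_max_of_lt_right hk)]
    unfold gen
    rw [H (a / 5 + 2) (lt_max_of_lt_left (by omega)), h0, h1]

lemma eval_congr {z' : Jet} : ∀ (P : DiffPoly), (∀ k < ord P, z k = z' k) →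
    eval F P z = eval F P z'
  | [], _ => rfl
  | t :: P, H => by
    have h0 := H 0 (lt_max_of_lt_right (by have := two_le_ord P; omega))
    have h1 := H 1 (lt_max_of_lt_right (by have := two_le_ord P; omega))
    rw [eval_cons, eval_cons, eval_congr P fun k hk => H k (lt_max_of_lt_right hk),
      mon_congr h0 h1 t.2.2 fun k hk => H k (lt_max_of_lt_left hk), h1]

end DiffPoly

/-! ### Smoothness and derivatives of the values -/

lemma contDiffOn_iteratedDeriv {I : Set ℝ} (hI : IsOpen I) {g : ℝ → ℝ} (hg : ContDiffOn ℝ ∞ g I)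
    (n : ℕ) : ContDiffOn ℝ ∞ (iteratedDeriv n g) I := by
  induction n with
  | zero => simpa using hg
  | succ n ih =>
    rw [iteratedDeriv_succ]
    exact ih.deriv_of_isOpen hI (by simp)

lemma hasDerivAt_iteratedDeriv {I : Set ℝ} (hI : IsOpen I) {g : ℝ → ℝ} (hg : ContDiffOn ℝ ∞ g I)
    (n : ℕ) {x : ℝ} (hx : x ∈ I) :
    HasDerivAt (iteratedDeriv n g) (iteratedDeriv (n + 1) g x) x := by
  rw [iteratedDeriv_succ]
  exact (((contDiffOn_iteratedDeriv hI hg n).contDiffAt (hI.mem_nhds hx)).differentiableAt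
    (by simp)).hasDerivAt

namespace DiffPoly

variable {I : Set ℝ} {F : ℕ → ℝ → ℝ}

section
variable (hI : IsOpen I) (hF : ∀ i, ContDiffOn ℝ ∞ (F i) I)
include hI hF

/-- The space of infinite jets is not normable, so smoothness is stated along a map into it from a
normed space. -/
lemma contDiffOn_eval {E : Type*} [NormedAddCommGroup E] [NormedSpace ℝ E] {S : Set E}
    {y : E → Jet} (hy : ∀ k, ContDiffOn ℝ ∞ (fun x => y x k) S) (hS : ∀ x ∈ S, y x ∈ Dom I)
    (P : DiffPoly) : ContDiffOn ℝ ∞ (fun x => eval F P (y x)) S := by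
  have hgen : ∀ n, ContDiffOn ℝ ∞ (fun x => gen F (y x) n) S := by
    intro n
    unfold gen
    split_ifs
    · exact hy _
    · exact (hy 1).log fun x hx => (hS x hx).2
    · exact (contDiffOn_iteratedDeriv hI (hF _) _).comp (hy 0) fun x hx => (hS x hx).1
  have hmon : ∀ l, ContDiffOn ℝ ∞ (fun x => mon F (y x) l) S := by
    intro l
    induction l with
    | nil => exact contDiffOn_const
    | cons a l ih => simpa only [mon_cons] using (hgen a).mul ih
  have hpow : ∀ e : ℤ, ContDiffOn ℝ ∞ (fun x => y x 1 ^ e) S := by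
    rintro (e | e)
    · simpa using (hy 1).pow e
    · simp only [zpow_negSucc]
      exact ((hy 1).pow _).inv fun x hx => pow_ne_zero _ (hS x hx).2
  induction P with
  | nil => exact contDiffOn_const
  | cons t P ih =>
    simp only [eval_cons]
    exact (contDiffOn_const.mul ((hpow _).mul (hmon _))).add ih

lemma hasDerivAt_eval {y : ℝ → Jet} {h : Jet} {t : ℝ}
    (hy : ∀ k, HasDerivAt (fun x => y x k) (h k) t)
    (ht : y t ∈ Dom I) (P : DiffPoly) :
    HasDerivAt (fun x => eval F P (y x)) (deval F P (y t) h) t := by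
  have hgen : ∀ n, HasDerivAt (fun x => gen F (y x) n) (dgen F (y t) h n) t := by
    intro n
    unfold gen dgen
    split_ifs
    · exact hy _
    · exact (hy 1).log ht.2
    · exact (hasDerivAt_iteratedDeriv hI (hF _) _ ht.1).comp t (hy 0)
  have hmon : ∀ l, HasDerivAt (fun x => mon F (y x) l) (dmon F (y t) h l) t := by
    intro l
    induction l with
    | nil => exact hasDerivAt_const _ _
    | cons a l ih =>
      simp only [mon_cons, dmon]
      exact ((hgen a).mul ih).congr_deriv (by ring)
  have hpow : ∀ e : ℤ, HasDerivAt (fun x => y x 1 ^ e) (e * y t 1 ^ (e - 1) * h 1) t := by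
    intro e
    have h1 := HasDerivAt.comp t (hasDerivAt_zpow e (y t 1) (Or.inl ht.2)) (hy 1)
    exact h1
  induction P with
  | nil => exact hasDerivAt_const _ _
  | cons t P ih =>
    simp only [eval_cons, deval_cons]
    exact (((hpow _).mul (hmon _)).const_mul _).add ih

end

/-! ### Agreement of the computed operators with the analytic ones. -/

/-- `g` is given on `Dom I` by the differential polynomial `P`. -/
def Represents (I : Set ℝ) (F : ℕ → ℝ → ℝ) (P : DiffPoly) (g : JetFun) : Prop :=
  ∀ z ∈ Dom I, g z = eval F P z

lemma represents_eval (P : DiffPoly) : Represents I F P (eval F P) := fun _ _ => rfl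

section
variable (hI : IsOpen I)
include hI

lemma eventually_update_mem {z : Jet} (hz : z ∈ Dom I) (k : ℕ) :
    ∀ᶠ t in 𝓝 (z k), Function.update z k t ∈ Dom I := by
  have h1 : Continuous fun t => Function.update z k t := continuous_const.update k continuous_id
  have h2 : IsOpen (Dom I) := (hI.preimage (continuous_apply 0)).inter
    (isOpen_ne.preimage (continuous_apply 1))
  have h3 := h1.continuousAt.preimage_mem_nhds (x := z k) (h2.mem_nhds (by simpa using hz))
  exact h3

variable (hF : ∀ i, ContDiffOn ℝ ∞ (F i) I)
include hF

lemma Represents.pderiv {P : DiffPoly} {g : JetFun} (h : Represents I F P g) (k : ℕ) :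
    Represents I F (pd k P) (pderiv k g) := by
  intro z hz
  have h1 : (fun t => g (Function.update z k t)) =ᶠ[𝓝 (z k)]
      fun t => eval F P (Function.update z k t) := by
    filter_upwards [eventually_update_mem hI hz k] with t ht using h _ ht
  have h2 : HasDerivAt (fun t => eval F P (Function.update z k t))
      (deval F P z (Pi.single k 1)) (z k) := by
    have h3 := hasDerivAt_eval (F := F) hI hF (y := fun t => Function.update z k t)
      (h := Pi.single k 1) (t := z k) (fun j => ?_) (by simpa using hz) P
    · simpa using h3
    · by_cases hj : j = k
      · subst hj; simpa using hasDerivAt_id' (z j)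
      · simpa [hj] using hasDerivAt_const (z k) (z j)
  rw [Quasitriviality.pderiv, h1.deriv_eq, h2.deriv, eval_pd hz.2]

/-- The common shape of `totalD` and `evol`; only the weights `w` differ. -/
lemma Represents.finsum {P : DiffPoly} {g : JetFun} (h : Represents I F P g) {z : Jet}
    (hz : z ∈ Dom I) (w : Jet) :
    ∑ᶠ k : ℕ, w k * Quasitriviality.pderiv k g z = deval F P z w := by
  have h1 : ∀ k, Quasitriviality.pderiv k g z = deval F P z (Pi.single k 1) := fun k => by
    rw [h.pderiv hI hF k z hz, eval_pd hz.2]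
  simp only [h1]
  rw [deval_eq_sum P le_rfl z w]
  refine finsum_eq_sum_of_support_subset _ fun k hk => ?_
  by_contra hk'
  refine hk ?_
  have h2 : deval F P z (Pi.single k 1) = deval F P z 0 := by
    refine deval_congr P fun j hj => ?_
    have : j ≠ k := by
      rintro rfl
      exact hk' (by simpa using hj)
    simp [this]
  simp [h2, deval_zero]

lemma Represents.totalD {P : DiffPoly} {g : JetFun} (h : Represents I F P g) :
    Represents I F (total P) (totalD g) := fun z hz => by
  rw [eval_total hz.2, Quasitriviality.totalD, h.finsum hI hF hz fun k => z (k + 1)]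

lemma Represents.totalD_iterate {P : DiffPoly} {g : JetFun} (h : Represents I F P g) (k : ℕ) :
    Represents I F (total^[k] P) (Quasitriviality.totalD^[k] g) := by
  induction k with
  | zero => exact h
  | succ k ih =>
    rw [Function.iterate_succ_apply', Function.iterate_succ_apply']
    exact ih.totalD hI hF

lemma Represents.evol {W P : DiffPoly} {w g : JetFun} (hw : Represents I F W w)
    (h : Represents I F P g) : Represents I F (ev W P) (evol w g) := fun z hz => by
  rw [eval_ev hz.2, Quasitriviality.evol,
    h.finsum hI hF hz fun k => (Quasitriviality.totalD^[k] w) z]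
  exact deval_congr P fun k _ => hw.totalD_iterate hI hF k z hz

lemma eval_total_of_eval_eq_zero {P : DiffPoly} (h : Represents I F P 0) :
    Represents I F (total P) 0 := by
  intro z hz
  rw [← h.totalD hI hF z hz]
  have h1 : ∀ k, Quasitriviality.pderiv k (0 : JetFun) z = 0 := fun k => by
    simp [Quasitriviality.pderiv]
  simp [Quasitriviality.totalD, h1]

/-- Beyond the order bound the partial derivative vanishes as a function. Its list need not be shown
empty, since representing the zero function is preserved by `total`. -/
lemma eval_total_iterate_pd {P : DiffPoly} {k : ℕ} (hk : ord P ≤ k) :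
    Represents I F (total^[k] (pd k P)) 0 := by
  have h0 : Represents I F (pd k P) 0 := fun z hz => by
    rw [eval_pd hz.2]
    refine ((deval_congr P fun j hj => ?_).trans (deval_zero P)).symm
    have : j ≠ k := by omega
    simp [this]
  have h1 : ∀ j, Represents I F (total^[j] (pd k P)) 0 := by
    intro j
    induction j with
    | zero => exact h0
    | succ j ih =>
      rw [Function.iterate_succ_apply']
      exact eval_total_of_eval_eq_zero hI hF ih
  exact h1 k

lemma Represents.euler {P : DiffPoly} {g : JetFun} (h : Represents I F P g) :
    Represents I F (eulerLagrange P) (euler g) := by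
  intro z hz
  have h1 : ∀ k, (Quasitriviality.totalD^[k] (Quasitriviality.pderiv k g)) z
      = eval F (total^[k] (pd k P)) z :=
    fun k => (h.pderiv hI hF k).totalD_iterate hI hF k z hz
  simp only [Quasitriviality.euler, h1]
  rw [finsum_eq_sum_of_support_subset (s := Finset.range (ord P))]
  · rw [eulerLagrange, eval_sum, List.map_map]
    rw [Finset.sum_range, ← List.sum_ofFn, ← List.map_coe_finRange_eq_range, List.map_map]
    rw [List.ofFn_eq_map]
    simp [eval_mulTerm hz.2, Function.comp_def]
  · intro k hk
    by_contra hk'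
    refine hk ?_
    have := eval_total_iterate_pd hI hF (P := P) (k := k) (by simpa using hk') z hz
    simp [← this]

end

lemma isLocal_eval (hI : IsOpen I) (hF : ∀ i, ContDiffOn ℝ ∞ (F i) I) (P : DiffPoly) :
    IsLocal I (eval F P) := by
  -- The finitely many given jet variables are extended by zero to an infinite jet; the variables
  -- set to zero do not occur in `P`.
  refine ⟨ord P, fun y => eval F P fun k => if hk : k < ord P + 2 then y ⟨k, hk⟩ else 0, ?_, ?_⟩
  · refine contDiffOn_eval hI hF (fun k => ?_) (fun y hy => ?_) P
    · split_ifs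
      · exact (contDiff_apply ℝ ℝ _).contDiffOn
      · exact contDiffOn_const
    · refine ⟨?_, ?_⟩
      · simpa using hy.1
      · simpa using hy.2
  · intro z _
    refine eval_congr P fun k hk => ?_
    simp [show k < ord P + 2 by omega]

lemma Represents.congr {P Q : DiffPoly} {g : JetFun} (h : Represents I F P g)
    (H : same P Q = true) : Represents I F Q g := fun z hz =>
  (h z hz).trans (eval_eq_of_same hz.2 H)

lemma Represents.add {P Q : DiffPoly} {g g' : JetFun} (h : Represents I F P g)
    (h' : Represents I F Q g') : Represents I F (add P Q) (g + g') := fun z hz => by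
  rw [eval_add, ← h z hz, ← h' z hz, Pi.add_apply]

lemma Represents.smul {P : DiffPoly} {g : JetFun} (h : Represents I F P g) {a : ℝ} (q : ℚ)
    (ha : a = q) : Represents I F (smul q P) (a • g) := fun z hz => by
  rw [eval_smul hz.2, ← h z hz, Pi.smul_apply, ha, smul_eq_mul]

end DiffPoly

/-! ### The coefficients of the power series -/

@[simp] lemma pderiv_zero (k : ℕ) : pderiv k 0 = 0 := by
  ext z; simp [pderiv]

@[simp] lemma totalD_zero : totalD 0 = 0 := by
  ext z; simp [totalD]

@[simp] lemma totalD_iterate_zero (k : ℕ) : totalD^[k] 0 = 0 := by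
  induction k with
  | zero => rfl
  | succ k ih => rw [Function.iterate_succ_apply', ih, totalD_zero]

@[simp] lemma euler_zero : euler 0 = 0 := by
  ext z; simp [euler]

@[simp] lemma evol_zero_left (g : JetFun) : evol 0 g = 0 := by
  ext z; simp [evol]

@[simp] lemma evol_zero_right (w : JetFun) : evol w 0 = 0 := by
  ext z; simp [evol]

lemma evol_coord_zero (w : JetFun) : evol w (coord 0) = w := by
  ext z
  have h1 : ∀ k, k ≠ 0 → pderiv k (coord 0) z = 0 := fun k hk => by
    simp [pderiv, coord, Function.update_of_ne hk.symm]
  have h2 : pderiv 0 (coord 0) z = 1 := by simp [pderiv, coord]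
  rw [evol, finsum_eq_single _ 0 fun k hk => by rw [h1 k hk, mul_zero], h2]
  simp

lemma coeff_hamField (h : EpsFun) (n : ℕ) :
    PowerSeries.coeff n (hamField h) = totalD (euler (PowerSeries.coeff n h)) := by
  simp [hamField]

/-- A power series of the form `ε κ₁ + ε³ κ₃`. -/
def odd3 (κ₁ κ₃ : JetFun) : EpsFun := PowerSeries.monomial 1 κ₁ + PowerSeries.monomial 3 κ₃

/-- The iterated brackets of `u` with the functional of density `ε κ₁ + ε³ κ₃`. -/
def iterBracket (κ₁ κ₃ : JetFun) (m : ℕ) : EpsFun :=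
  (fun F => bracket F (odd3 κ₁ κ₃))^[m] (PowerSeries.C (coord 0))

section
variable (κ₁ κ₃ : JetFun)

lemma coeff_odd3 (n : ℕ) : PowerSeries.coeff n (odd3 κ₁ κ₃) =
    if n = 1 then κ₁ else if n = 3 then κ₃ else 0 := by
  rw [odd3, map_add, PowerSeries.coeff_monomial, PowerSeries.coeff_monomial]
  split_ifs <;> first | omega | simp

lemma coeff_hamField_odd3 (n : ℕ) : PowerSeries.coeff n (hamField (odd3 κ₁ κ₃)) =
    if n = 1 then totalD (euler κ₁) else if n = 3 then totalD (euler κ₃) else 0 := by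
  rw [coeff_hamField, coeff_odd3]
  split_ifs <;> simp

lemma iterBracket_succ (m n : ℕ) : PowerSeries.coeff n (iterBracket κ₁ κ₃ (m + 1)) =
    ∑ q ∈ Finset.HasAntidiagonal.antidiagonal n,
      evol (PowerSeries.coeff q.1 (hamField (odd3 κ₁ κ₃)))
      (PowerSeries.coeff q.2 (iterBracket κ₁ κ₃ m)) := by
  rw [iterBracket, Function.iterate_succ_apply']
  exact PowerSeries.coeff_mk _ _

/-- The Hamiltonian field has only the orders 1 and 3, so every bracket raises the order by a
positive odd number. After multiplication by ε^m only even orders from 2m on survive, and below ε⁶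
just m ≤ 2 counts. -/
lemma coeff_iterBracket_eq_zero (m : ℕ) : ∀ n, ¬ (m ≤ n ∧ (n - m) % 2 = 0 ∧ (m = 0 → n = 0)) →
    PowerSeries.coeff n (iterBracket κ₁ κ₃ m) = 0 := by
  induction m with
  | zero =>
    intro n hn
    have : n ≠ 0 := by rintro rfl; simp at hn
    simp [iterBracket, PowerSeries.coeff_C, this]
  | succ m ih =>
    intro n hn
    rw [iterBracket_succ]
    refine Finset.sum_eq_zero fun q hq => ?_
    have hq' := Finset.HasAntidiagonal.mem_antidiagonal.1 hq
    rw [coeff_hamField_odd3]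
    by_cases h2 : m ≤ q.2 ∧ (q.2 - m) % 2 = 0 ∧ (m = 0 → q.2 = 0)
    · rw [if_neg (by omega), if_neg (by omega), evol_zero_left]
    · rw [ih _ h2, evol_zero_right]

lemma coeff_iterBracket_one_one :
    PowerSeries.coeff 1 (iterBracket κ₁ κ₃ 1) = totalD (euler κ₁) := by
  rw [iterBracket_succ]
  simp [Finset.Nat.antidiagonal_succ, coeff_hamField_odd3, iterBracket, evol_coord_zero]

lemma coeff_iterBracket_one_three :
    PowerSeries.coeff 3 (iterBracket κ₁ κ₃ 1) = totalD (euler κ₃) := by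
  rw [iterBracket_succ]
  simp [Finset.Nat.antidiagonal_succ, coeff_hamField_odd3, iterBracket, evol_coord_zero,
    PowerSeries.coeff_C]

lemma coeff_iterBracket_two_two : PowerSeries.coeff 2 (iterBracket κ₁ κ₃ 2) =
    evol (totalD (euler κ₁)) (totalD (euler κ₁)) := by
  rw [iterBracket_succ]
  simp [Finset.Nat.antidiagonal_succ, coeff_hamField_odd3, coeff_iterBracket_one_one]

lemma coeff_canonical_odd3 (n : ℕ) : PowerSeries.coeff n (canonical (odd3 κ₁ κ₃)) =
    ∑ m ∈ Finset.range (n + 1), ((m ! : ℝ)⁻¹) • PowerSeries.coeff (n - m) (iterBracket κ₁ κ₃ m) := by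
  rw [canonical, PowerSeries.coeff_mk]
  refine Finset.sum_congr rfl fun m hm => ?_
  rw [PowerSeries.coeff_X_pow_mul', if_pos (Nat.lt_succ_iff.1 (Finset.mem_range.1 hm))]
  rfl

lemma coeff_canonical_zero : PowerSeries.coeff 0 (canonical (odd3 κ₁ κ₃)) = coord 0 := by
  simp [coeff_canonical_odd3, iterBracket]

lemma coeff_canonical_of_odd {n : ℕ} (hn : n % 2 = 1) :
    PowerSeries.coeff n (canonical (odd3 κ₁ κ₃)) = 0 := by
  rw [coeff_canonical_odd3]
  refine Finset.sum_eq_zero fun m _ => ?_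
  rw [coeff_iterBracket_eq_zero _ _ _ _ (by omega), smul_zero]

lemma coeff_canonical_two :
    PowerSeries.coeff 2 (canonical (odd3 κ₁ κ₃)) = totalD (euler κ₁) := by
  rw [coeff_canonical_odd3, Finset.sum_eq_single 1]
  · simp [coeff_iterBracket_one_one]
  · intro m _ hm
    rw [coeff_iterBracket_eq_zero _ _ _ _ (by omega), smul_zero]
  · simp

lemma coeff_canonical_four : PowerSeries.coeff 4 (canonical (odd3 κ₁ κ₃)) =
    totalD (euler κ₃) + (1 / 2 : ℝ) • evol (totalD (euler κ₁)) (totalD (euler κ₁)) := by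
  rw [coeff_canonical_odd3, ← Finset.sum_subset (s₁ := {1, 2})]
  · simp [coeff_iterBracket_one_three, coeff_iterBracket_two_two]
  · intro m
    simp
    omega
  · intro m _ hm
    simp at hm
    rw [coeff_iterBracket_eq_zero _ _ _ _ (by omega), smul_zero]

end

/-- The coefficients of `ε^k`, `k < 6`, are those of `u + ε² T₁ + ε⁴ T₂`. -/
structure IsEvenExpansion (V : EpsFun) (T₀ T₁ T₂ : JetFun) : Prop where
  zero : PowerSeries.coeff 0 V = T₀
  one : PowerSeries.coeff 1 V = 0
  two : PowerSeries.coeff 2 V = T₁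
  three : PowerSeries.coeff 3 V = 0
  four : PowerSeries.coeff 4 V = T₂
  five : PowerSeries.coeff 5 V = 0

lemma isEvenExpansion_canonical (κ₁ κ₃ : JetFun) :
    IsEvenExpansion (canonical (odd3 κ₁ κ₃)) (coord 0) (totalD (euler κ₁))
      (totalD (euler κ₃) + (1 / 2 : ℝ) • evol (totalD (euler κ₁)) (totalD (euler κ₁))) :=
  ⟨coeff_canonical_zero κ₁ κ₃, coeff_canonical_of_odd κ₁ κ₃ rfl, coeff_canonical_two κ₁ κ₃,
    coeff_canonical_of_odd κ₁ κ₃ rfl, coeff_canonical_four κ₁ κ₃,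
    coeff_canonical_of_odd κ₁ κ₃ rfl⟩

lemma isEvenExpansion_monomial (h₀ h₂ h₄ : JetFun) : IsEvenExpansion
    (PowerSeries.monomial 0 h₀ + PowerSeries.monomial 2 h₂ + PowerSeries.monomial 4 h₄)
    h₀ h₂ h₄ := by
  constructor <;> simp [PowerSeries.coeff_monomial, -PowerSeries.coeff_zero_eq_constantCoeff]

lemma IsEvenExpansion.hamField {h : EpsFun} {h₀ h₂ h₄ : JetFun} (H : IsEvenExpansion h h₀ h₂ h₄) :
    IsEvenExpansion (hamField h) (totalD (euler h₀)) (totalD (euler h₂)) (totalD (euler h₄)) := by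
  constructor <;> simp [coeff_hamField, H.zero, H.one, H.two, H.three, H.four, H.five]

lemma IsEvenExpansion.eval6 {V : EpsFun} {T₀ T₁ T₂ : JetFun} (H : IsEvenExpansion V T₀ T₁ T₂)
    (ε : ℝ) (z : Jet) : eval6 V ε z = T₀ z + ε ^ 2 * T₁ z + ε ^ 4 * T₂ z := by
  simp [Quasitriviality.eval6, Finset.sum_range_succ, H.zero, H.one, H.two, H.three, H.four, H.five]

lemma IsEvenExpansion.applyFun {V : EpsFun} {T₁ T₂ : JetFun}
    (H : IsEvenExpansion V (coord 0) T₁ T₂) (f : ℝ → ℝ) :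
    IsEvenExpansion (applyFun f V) (fun z => f (z 0)) (fun z => iteratedDeriv 1 f (z 0) * T₁ z)
      (fun z => iteratedDeriv 1 f (z 0) * T₂ z + iteratedDeriv 2 f (z 0) / 2 * T₁ z ^ 2) := by
  -- Since V - u is divisible by ε², its j-th power starts at order 2j, and below ε⁶ only j ≤ 2
  -- contributes to the Taylor series.
  set S : EpsFun := PowerSeries.mk fun n => PowerSeries.coeff (n + 2) V with hS
  have h1 : V - PowerSeries.C (coord 0) = PowerSeries.X ^ 2 * S := by
    ext1 n
    rw [PowerSeries.coeff_X_pow_mul', map_sub, PowerSeries.coeff_C]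
    rcases n with _ | _ | n
    · simp [H.zero]
    · simp [H.one]
    · simp [hS]
  have h2 : ∀ j n, PowerSeries.coeff n ((V - PowerSeries.C (coord 0)) ^ j) =
      if 2 * j ≤ n then PowerSeries.coeff (n - 2 * j) (S ^ j) else 0 := fun j n => by
    rw [h1, mul_pow, ← pow_mul, PowerSeries.coeff_X_pow_mul']
  have h3 : PowerSeries.coeff 0 (S ^ 2) = T₁ ^ 2 := by
    simp [hS, H.two]
  have h4 : PowerSeries.coeff 1 (S ^ 2) = 0 := by
    simp [sq, PowerSeries.coeff_mul, Finset.Nat.antidiagonal_succ, hS, H.three]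
  have hS0 : PowerSeries.coeff 0 S = T₁ := by rw [hS, PowerSeries.coeff_mk, H.two]
  have hS1 : PowerSeries.coeff 1 S = 0 := by rw [hS, PowerSeries.coeff_mk, H.three]
  have hS2 : PowerSeries.coeff 2 S = T₂ := by rw [hS, PowerSeries.coeff_mk, H.four]
  have hS3 : PowerSeries.coeff 3 S = 0 := by rw [hS, PowerSeries.coeff_mk, H.five]
  constructor <;> ext z <;>
    simp [Quasitriviality.applyFun, Finset.sum_range_succ, h2, h3, h4, hS0, hS1, hS2, hS3,
      PowerSeries.coeff_one, -PowerSeries.coeff_zero_eq_constantCoeff]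

/-! ### Taylor expansions -/

/-- Induction on n: the Taylor remainder vanishes at 0, and its derivative is the remainder of the
shifted sequence, so the mean value inequality on [0, 1] preserves the bound. The factor 1/n! is
given up, as only the order of magnitude matters. -/
lemma abs_sub_taylor_le {C : ℝ} (hC : 0 ≤ C) (n : ℕ) : ∀ y : ℕ → ℝ → ℝ,
    (∀ m, ∀ t ∈ Icc (0 : ℝ) 1, HasDerivAt (y m) (y (m + 1) t) t) →
    (∀ t ∈ Icc (0 : ℝ) 1, |y n t| ≤ C) → ∀ t ∈ Icc (0 : ℝ) 1,
      |y 0 t - ∑ m ∈ Finset.range n, y m 0 * (t ^ m / (m ! : ℝ))| ≤ C := by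
  induction n with
  | zero => intro y _ h t ht; simpa using h t ht
  | succ n ih =>
    intro y hy h t ht
    have h1 := ih (fun m => y (m + 1)) (fun m => hy (m + 1)) h
    set G : ℝ → ℝ := fun t => y 0 t - ∑ m ∈ Finset.range (n + 1), y m 0 * (t ^ m / (m ! : ℝ))
      with hG
    have h2 : ∀ t ∈ Icc (0 : ℝ) 1, HasDerivWithinAt G
        (y 1 t - ∑ m ∈ Finset.range n, y (m + 1) 0 * (t ^ m / (m ! : ℝ))) (Icc 0 1) t := by
      intro t ht
      refine ((hy 0 t ht).sub ?_).hasDerivWithinAt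
      simp only [Finset.sum_range_succ' _ n, pow_zero]
      refine HasDerivAt.add_const _ (HasDerivAt.fun_sum fun m _ => ?_)
      refine ((hasDerivAt_pow (m + 1) t).div_const _).const_mul _ |>.congr_deriv ?_
      rw [Nat.factorial_succ]
      push_cast
      field_simp
    have h3 := norm_image_sub_le_of_norm_deriv_le_segment' h2
      (fun x hx => h1 x (Ico_subset_Icc_self hx)) t ht
    have h4 : G 0 = 0 := by simp [hG, Finset.sum_range_succ']
    rw [h4, sub_zero, sub_zero] at h3
    exact h3.trans (mul_le_of_le_one_right hC ht.2)

namespace DiffPoly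

variable {I : Set ℝ} {F : ℕ → ℝ → ℝ}

/-- The iterated directional derivatives `d^m P(h, …, h)` at `z`. -/
def dd (F : ℕ → ℝ → ℝ) : ℕ → DiffPoly → Jet → Jet → ℝ
  | 0, P, z, _ => eval F P z
  | m + 1, P, z, h => ∑ k ∈ Finset.range (ord P), h k * dd F m (pd k P) z h

lemma dd_one {z : Jet} (hz : z 1 ≠ 0) (P : DiffPoly) (h : Jet) : dd F 1 P z h = deval F P z h := by
  rw [deval_eq_sum P le_rfl]
  simp [dd, eval_pd hz]

lemma continuousAt_eval (hI : IsOpen I) (hF : ∀ i, ContDiffOn ℝ ∞ (F i) I) {z : Jet}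
    (hz : z ∈ Dom I) (P : DiffPoly) : ContinuousAt (eval F P) z := by
  have hc : ∀ k, ContinuousAt (fun y : Jet => y k) z := fun k => (continuous_apply k).continuousAt
  have hgen : ∀ n, ContinuousAt (fun y => gen F y n) z := by
    intro n
    unfold gen
    split_ifs
    · exact hc _
    · exact (hc 1).log hz.2
    · exact ContinuousAt.comp (f := fun y : Jet => y 0)
        (hasDerivAt_iteratedDeriv hI (hF _) _ hz.1).continuousAt (hc 0)
  have hmon : ∀ l, ContinuousAt (fun y => mon F y l) z := by
    intro l
    induction l with
    | nil => exact continuousAt_const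
    | cons a l ih =>
      simp only [mon_cons]
      exact (hgen a).mul ih
  induction P with
  | nil => exact continuousAt_const
  | cons t P ih =>
    have : eval F (t :: P) = fun y =>
      (t.1 : ℝ) * (y 1 ^ t.2.1 * mon F y t.2.2) + eval F P y := funext fun _ => eval_cons _ _
    rw [this]
    exact (continuousAt_const.mul (((hc 1).zpow₀ _ (Or.inl hz.2)).mul (hmon _))).add ih

section
variable (hI : IsOpen I) (hF : ∀ i, ContDiffOn ℝ ∞ (F i) I)
include hI hF

lemma isBigO_eval {α : Type*} {l : Filter α} {y : α → Jet} {z : Jet} (hz : z ∈ Dom I)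
    (hy : Tendsto y l (𝓝 z)) (P : DiffPoly) : (fun a => eval F P (y a)) =O[l] fun _ => (1 : ℝ) :=
  ((continuousAt_eval hI hF hz P).tendsto.comp hy).isBigO_one ℝ

lemma isBigO_dd {α : Type*} {l : Filter α} {y h : α → Jet} {g : α → ℝ} {z : Jet} (hz : z ∈ Dom I)
    (hy : Tendsto y l (𝓝 z)) (hh : ∀ k, (fun a => h a k) =O[l] g) (m : ℕ) : ∀ P : DiffPoly,
    (fun a => dd F m P (y a) (h a)) =O[l] fun a => g a ^ m := by
  induction m with
  | zero =>
    intro P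
    simpa only [dd, pow_zero] using isBigO_eval hI hF hz hy P
  | succ m ih =>
    intro P
    simp only [dd]
    refine IsBigO.fun_sum fun k _ => ?_
    simpa only [pow_succ'] using (hh k).mul (ih (pd k P))

/-- Along a line the direction is constant, so differentiating in t raises `m` by one. This supplies
the sequence of derivatives for `abs_sub_taylor_le`. -/
lemma hasDerivAt_dd {z h : Jet} {t : ℝ} (ht : z + t • h ∈ Dom I) (m : ℕ) : ∀ P : DiffPoly,
    HasDerivAt (fun t => dd F m P (z + t • h) h) (dd F (m + 1) P (z + t • h) h) t := by
  induction m with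
  | zero =>
    intro P
    rw [dd_one ht.2]
    refine hasDerivAt_eval hI hF (y := fun t => z + t • h) (fun k => ?_) ht P
    simpa using ((hasDerivAt_id' t).mul_const (h k)).const_add (z k)
  | succ m ih =>
    intro P
    simp only [dd]
    refine HasDerivAt.fun_sum fun k _ => ?_
    simpa only [dd] using (ih (pd k P)).const_mul (h k)

/-- Taylor's formula at a moving point, with a uniform estimate of the remainder. -/
lemma isBigO_eval_sub_taylor {y h : ℝ → Jet} {g : ℝ → ℝ} {z : Jet} (hz : z ∈ Dom I)
    (hy : Tendsto y (𝓝 0) (𝓝 z)) (hh : ∀ k, (fun a => h a k) =O[𝓝 0] g)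
    (hg : Tendsto g (𝓝 0) (𝓝 0)) (n : ℕ) (P : DiffPoly) :
    (fun a => eval F P (y a + h a) - ∑ m ∈ Finset.range n, dd F m P (y a) (h a) / (m ! : ℝ))
      =O[𝓝 0] fun a => g a ^ n := by
  -- The product with the principal filter of [0, 1] expresses uniformity along the segment from `y
  -- a` to `y a + h a`.
  have hl : Tendsto (fun q : ℝ × ℝ => y q.1 + q.2 • h q.1) (𝓝 0 ×ˢ 𝓟 (Icc 0 1)) (𝓝 z) := by
    refine tendsto_pi_nhds.2 fun k => ?_
    have h1 : Tendsto (fun q : ℝ × ℝ => y q.1 k) (𝓝 0 ×ˢ 𝓟 (Icc (0 : ℝ) 1)) (𝓝 (z k)) :=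
      (tendsto_pi_nhds.1 hy k).comp tendsto_fst
    have h2 : Tendsto (fun q : ℝ × ℝ => h q.1 k) (𝓝 0 ×ˢ 𝓟 (Icc (0 : ℝ) 1)) (𝓝 0) :=
      ((hh k).trans_tendsto hg).comp tendsto_fst
    have h3 : (fun q : ℝ × ℝ => q.2) =O[𝓝 0 ×ˢ 𝓟 (Icc (0 : ℝ) 1)] fun _ => (1 : ℝ) := by
      refine IsBigO.of_bound 1 ?_
      filter_upwards [tendsto_snd.eventually (mem_principal_self (Icc (0 : ℝ) 1))] with q hq
      simpa [abs_of_nonneg hq.1] using hq.2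
    have h4 : Tendsto (fun q : ℝ × ℝ => q.2 * h q.1 k) (𝓝 0 ×ˢ 𝓟 (Icc (0 : ℝ) 1)) (𝓝 0) :=
      (h3.mul (isBigO_refl _ _)).trans_tendsto (by simpa using h2)
    simpa using h1.add h4
  have hb := isBigO_dd hI hF hz hl (h := fun q => h q.1) (g := fun q => g q.1)
    (fun k => (hh k).comp_tendsto tendsto_fst) n P
  obtain ⟨C, hC, hb⟩ := hb.exists_nonneg
  have hD : ∀ᶠ q in 𝓝 (0 : ℝ) ×ˢ 𝓟 (Icc (0 : ℝ) 1), y q.1 + q.2 • h q.1 ∈ Dom I := by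
    have h2 : IsOpen (Dom I) := (hI.preimage (continuous_apply 0)).inter
      (isOpen_ne.preimage (continuous_apply 1))
    exact hl.eventually (h2.mem_nhds hz)
  have h5 := eventually_prod_principal_iff.1 (hD.and hb.bound)
  refine IsBigO.of_bound C ?_
  filter_upwards [h5] with a ha
  have h6 := abs_sub_taylor_le (C := C * ‖g a ^ n‖) (by positivity) n
    (fun m t => dd F m P (y a + t • h a) (h a))
    (fun m t ht => hasDerivAt_dd hI hF (ha t ht).1 m P) (fun t ht => (ha t ht).2) 1 (by simp)
  simpa [dd, div_eq_mul_inv] using h6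

end

end DiffPoly

/-! ### Smooth functions that are `O(ε^n)` -/

/-- Once the derivatives of order < j vanish, the Taylor polynomial of degree j is a single
monomial; if `g` is of smaller order than ε^j, so is this monomial, and its coefficient is zero. The
point is to turn an estimate into equations at ε = 0, which can be differentiated in further
variables. -/
lemma isBigO_pow_iff {g : ℝ → ℝ} {U : Set ℝ} (hU : IsOpen U) (h0 : (0 : ℝ) ∈ U)
    (hg : ContDiffOn ℝ ∞ g U) (n : ℕ) :
    g =O[𝓝 0] (fun ε => ε ^ n) ↔ ∀ j < n, iteratedDeriv j g 0 = 0 := by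
  obtain ⟨r, hr, hball⟩ := Metric.isOpen_iff.1 hU 0 h0
  have hT : ∀ m : ℕ, (fun x => g x - ∑ k ∈ Finset.range (m + 1),
      ((k ! : ℝ)⁻¹ * x ^ k) * iteratedDeriv k g 0) =o[𝓝 0] fun x => x ^ m := by
    intro m
    have h1 := taylor_isLittleO (n := m) (convex_ball (0 : ℝ) r) (Metric.mem_ball_self hr)
      ((hg.mono hball).of_le (by exact_mod_cast le_top))
    rw [Metric.isOpen_ball.nhdsWithin_eq (Metric.mem_ball_self hr)] at h1
    simpa only [taylor_within_apply, sub_zero, smul_eq_mul,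
      iteratedDerivWithin_of_isOpen Metric.isOpen_ball (Metric.mem_ball_self hr)] using h1
  constructor
  · intro h j
    induction j using Nat.strong_induction_on with
    | _ j ih =>
      intro hj
      have h1 := hT j
      have h2 : ∀ x : ℝ, ∑ k ∈ Finset.range (j + 1), ((k ! : ℝ)⁻¹ * x ^ k) * iteratedDeriv k g 0
          = ((j ! : ℝ)⁻¹ * iteratedDeriv j g 0) * x ^ j := by
        intro x
        rw [Finset.sum_range_succ, Finset.sum_eq_zero fun k hk => ?_]
        · ring
        · rw [ih k (Finset.mem_range.1 hk) ((Finset.mem_range.1 hk).trans hj), mul_zero]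
      simp only [h2] at h1
      have h3 : g =o[𝓝 0] fun x => x ^ j := h.trans_isLittleO (isLittleO_pow_pow (𝕜 := ℝ) hj)
      have h4 : (fun x : ℝ => ((j ! : ℝ)⁻¹ * iteratedDeriv j g 0) * x ^ j)
          =o[𝓝 0] fun x => x ^ j := by
        simpa using h3.sub h1
      have h5 := h4.mono (nhdsWithin_le_nhds (s := {0}ᶜ))
      rw [isLittleO_iff_tendsto'] at h5
      · have h6 : Tendsto (fun x : ℝ => ((j ! : ℝ)⁻¹ * iteratedDeriv j g 0) * x ^ j / x ^ j)
            (𝓝[≠] 0) (𝓝 ((j ! : ℝ)⁻¹ * iteratedDeriv j g 0)) := by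
          refine tendsto_const_nhds.congr' ?_
          filter_upwards [self_mem_nhdsWithin] with x hx
          rw [mul_div_cancel_right₀ _ (pow_ne_zero _ hx)]
        have h7 := tendsto_nhds_unique h6 h5
        exact (mul_eq_zero.1 h7).resolve_left (inv_ne_zero (by positivity))
      · filter_upwards [self_mem_nhdsWithin] with x hx h0
        exact absurd h0 (pow_ne_zero _ hx)
  · intro h
    have h1 := (hT n).isBigO
    have h2 : ∀ x : ℝ, ∑ k ∈ Finset.range (n + 1), ((k ! : ℝ)⁻¹ * x ^ k) * iteratedDeriv k g 0
        = ((n ! : ℝ)⁻¹ * iteratedDeriv n g 0) * x ^ n := by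
      intro x
      rw [Finset.sum_range_succ, Finset.sum_eq_zero fun k hk => ?_]
      · ring
      · rw [h k (Finset.mem_range.1 hk), mul_zero]
    simp only [h2] at h1
    simpa using h1.add (isBigO_const_mul_self ((n ! : ℝ)⁻¹ * iteratedDeriv n g 0) _ _)

/-- The derivative in the direction `e`. -/
def pdir {E : Type*} [NormedAddCommGroup E] [NormedSpace ℝ E] (e : E) (Φ : E → ℝ) : E → ℝ :=
  fun r => fderiv ℝ Φ r e

section
variable {E : Type*} [NormedAddCommGroup E] [NormedSpace ℝ E] {O : Set E} (hO : IsOpen O)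
include hO

lemma contDiffOn_pdir {Φ : E → ℝ} (hΦ : ContDiffOn ℝ ∞ Φ O) (e : E) :
    ContDiffOn ℝ ∞ (pdir e Φ) O :=
  (hΦ.fderiv_of_isOpen hO (by simp)).clm_apply contDiffOn_const

lemma contDiffOn_pdir_iterate {Φ : E → ℝ} (hΦ : ContDiffOn ℝ ∞ Φ O) (e : E) (n : ℕ) :
    ContDiffOn ℝ ∞ ((pdir e)^[n] Φ) O := by
  induction n with
  | zero => exact hΦ
  | succ n ih =>
    rw [Function.iterate_succ_apply']
    exact contDiffOn_pdir hO ih e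

lemma pdir_congr {Φ Ψ : E → ℝ} (h : ∀ r ∈ O, Φ r = Ψ r) (e : E) :
    ∀ r ∈ O, pdir e Φ r = pdir e Ψ r := fun r hr => by
  have : Φ =ᶠ[𝓝 r] Ψ := by
    filter_upwards [hO.mem_nhds hr] with x hx using h x hx
  rw [pdir, pdir, this.fderiv_eq]

lemma hasDerivAt_pdir {Φ : E → ℝ} (hΦ : ContDiffOn ℝ ∞ Φ O) {γ : ℝ → E} {e : E} {t : ℝ}
    (ht : γ t ∈ O) (hγ : HasDerivAt γ e t) : HasDerivAt (fun t => Φ (γ t)) (pdir e Φ (γ t)) t :=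
  (((hΦ.contDiffAt (hO.mem_nhds ht)).differentiableAt (by simp)).hasFDerivAt).comp_hasDerivAt t hγ

lemma pdir_comm {Φ : E → ℝ} (hΦ : ContDiffOn ℝ ∞ Φ O) (e e' : E) :
    ∀ r ∈ O, pdir e (pdir e' Φ) r = pdir e' (pdir e Φ) r := by
  intro r hr
  have h1 : ContDiffAt ℝ (2 : ℕ) Φ r :=
    contDiffAt_infty.1 (hΦ.contDiffAt (hO.mem_nhds hr)) 2
  have h2 : DifferentiableAt ℝ (fderiv ℝ Φ) r :=
    ((hΦ.fderiv_of_isOpen hO (m := ∞) (by simp)).contDiffAt (hO.mem_nhds hr)).differentiableAt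
      (by simp)
  have h3 : ∀ a b : E, pdir a (pdir b Φ) r = fderiv ℝ (fderiv ℝ Φ) r a b := by
    intro a b
    have h4 : HasFDerivAt (fun x => fderiv ℝ Φ x b)
        ((ContinuousLinearMap.apply ℝ ℝ b).comp (fderiv ℝ (fderiv ℝ Φ) r)) r :=
      (ContinuousLinearMap.apply ℝ ℝ b).hasFDerivAt.comp r h2.hasFDerivAt
    change fderiv ℝ (fun x => fderiv ℝ Φ x b) r a = _
    rw [h4.fderiv]
    rfl
  rw [h3, h3]
  exact (h1.isSymmSndFDerivAt (by simp)) e e'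

lemma pdir_iterate_comm {Φ : E → ℝ} (hΦ : ContDiffOn ℝ ∞ Φ O) (e e' : E) (n : ℕ) :
    ∀ r ∈ O, (pdir e)^[n] (pdir e' Φ) r = pdir e' ((pdir e)^[n] Φ) r := by
  induction n with
  | zero => intro r _; rfl
  | succ n ih =>
    intro r hr
    rw [Function.iterate_succ_apply', Function.iterate_succ_apply', pdir_congr hO ih e r hr,
      pdir_comm hO (contDiffOn_pdir_iterate hO hΦ e n) e e' r hr]

lemma iteratedDeriv_eq_pdir {Φ : E → ℝ} (hΦ : ContDiffOn ℝ ∞ Φ O) {γ : ℝ → E} {e : E}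
    (hγ : ∀ t, HasDerivAt γ e t) (k : ℕ) :
    ∀ t, γ t ∈ O → iteratedDeriv k (fun t => Φ (γ t)) t = (pdir e)^[k] Φ (γ t) := by
  induction k with
  | zero => intro t _; simp
  | succ k ih =>
    intro t ht
    have h1 : iteratedDeriv k (fun t => Φ (γ t)) =ᶠ[𝓝 t] fun t => (pdir e)^[k] Φ (γ t) := by
      filter_upwards [(hγ t).continuousAt.preimage_mem_nhds (hO.mem_nhds ht)] with t' ht'
        using ih t' ht'
    rw [iteratedDeriv_succ, h1.deriv_eq, Function.iterate_succ_apply',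
      (hasDerivAt_pdir hO (contDiffOn_pdir_iterate hO hΦ e k) ht (hγ t)).deriv]

end

section

open DiffPoly

/-! ### Substitutions -/

lemma isOpen_dom {I : Set ℝ} (hI : IsOpen I) : IsOpen (Dom I) :=
  (hI.preimage (continuous_apply 0)).inter (isOpen_ne.preimage (continuous_apply 1))

/-- Modulo `O(ε⁶)`, the power series `V` is `u + ε² P₁ + ε⁴ P₂`. -/
def Expands (I : Set ℝ) (F : ℕ → ℝ → ℝ) (V : EpsFun) (P₁ P₂ : DiffPoly) : Prop :=
  ∀ ε, ∀ z ∈ Dom I, eval6 V ε z = z 0 + (ε ^ 2 * eval F P₁ z + ε ^ 4 * eval F P₂ z)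

/-- The prolongation of `ε² P₁ + ε⁴ P₂`. -/
def push (F : ℕ → ℝ → ℝ) (P₁ P₂ : DiffPoly) (ε : ℝ) (z : Jet) : Jet :=
  fun k => ε ^ 2 * eval F (total^[k] P₁) z + ε ^ 4 * eval F (total^[k] P₂) z

variable {I : Set ℝ} {F : ℕ → ℝ → ℝ} {V V' : EpsFun} {P₁ P₂ P₁' P₂' : DiffPoly}

lemma deval_push {z : Jet} (hz : z 1 ≠ 0) (P : DiffPoly) (ε : ℝ) :
    deval F P z (push F P₁ P₂ ε z) = ε ^ 2 * eval F (ev P₁ P) z + ε ^ 4 * eval F (ev P₂ P) z := by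
  have h1 : push F P₁ P₂ ε z = ((0 : Jet) + ε ^ 2 • fun k => eval F (total^[k] P₁) z)
      + ε ^ 4 • fun k => eval F (total^[k] P₂) z := by
    ext k; simp [push]
  rw [h1, deval_add_smul, deval_add_smul, deval_zero, eval_ev hz, eval_ev hz, zero_add]

lemma hasDerivAt_jet {A : Set ℝ} (hA : IsOpen A) {w : ℝ → ℝ} (hw : ContDiffOn ℝ ∞ w A) {x : ℝ}
    (hx : x ∈ A) (k : ℕ) : HasDerivAt (fun y => jet w y k) (jet w x (k + 1)) x :=
  hasDerivAt_iteratedDeriv hA hw k hx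

section
variable (hI : IsOpen I) (hF : ∀ i, ContDiffOn ℝ ∞ (F i) I)
include hI hF

lemma isBigO_push {y : ℝ → Jet} {z : Jet} (hz : z ∈ Dom I) (hy : Tendsto y (𝓝 0) (𝓝 z)) (k : ℕ) :
    (fun ε => push F P₁ P₂ ε (y ε) k) =O[𝓝 0] fun ε => ε ^ 2 := by
  have h1 := (isBigO_refl (fun ε : ℝ => ε ^ 2) (𝓝 0)).mul (isBigO_eval hI hF hz hy (total^[k] P₁))
  have h2 := (isBigO_refl (fun ε : ℝ => ε ^ 4) (𝓝 0)).mul (isBigO_eval hI hF hz hy (total^[k] P₂))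
  have h3 : (fun ε : ℝ => ε ^ 4) =O[𝓝 0] fun ε => ε ^ 2 :=
    (isLittleO_pow_pow (𝕜 := ℝ) (by norm_num)).isBigO
  simp only [mul_one] at h1 h2
  exact h1.add (h2.trans h3)

lemma tendsto_add_push {y : ℝ → Jet} {z : Jet} (hz : z ∈ Dom I) (hy : Tendsto y (𝓝 0) (𝓝 z)) :
    Tendsto (fun ε => y ε + push F P₁ P₂ ε (y ε)) (𝓝 0) (𝓝 z) := by
  refine tendsto_pi_nhds.2 fun k => ?_
  have h1 := (tendsto_pi_nhds.1 hy k).add ((isBigO_push (P₁ := P₁) (P₂ := P₂) hI hF hz hy k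
    ).trans_tendsto (by simpa using (continuous_pow 2).tendsto (0 : ℝ)))
  simpa using h1

lemma isBigO_eval_add_push {y : ℝ → Jet} {z : Jet} (hz : z ∈ Dom I)
    (hy : Tendsto y (𝓝 0) (𝓝 z)) (n : ℕ) (P : DiffPoly) :
    (fun ε => eval F P (y ε + push F P₁ P₂ ε (y ε)) - ∑ m ∈ Finset.range n,
      dd F m P (y ε) (push F P₁ P₂ ε (y ε)) / (m ! : ℝ)) =O[𝓝 0] fun ε => ε ^ (2 * n) := by
  have h1 := isBigO_eval_sub_taylor hI hF hz hy (isBigO_push (P₁ := P₁) (P₂ := P₂) hI hF hz hy)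
    (by simpa using (continuous_pow 2).tendsto (0 : ℝ)) n P
  simpa only [← pow_mul] using h1

lemma isBigO_eval_add_push_one {y : ℝ → Jet} {z : Jet} (hz : z ∈ Dom I)
    (hy : Tendsto y (𝓝 0) (𝓝 z)) (P : DiffPoly) :
    (fun ε => eval F P (y ε + push F P₁ P₂ ε (y ε)) - eval F P (y ε)) =O[𝓝 0] fun ε => ε ^ 2 := by
  simpa [dd] using isBigO_eval_add_push (P₁ := P₁) (P₂ := P₂) hI hF hz hy 1 P

lemma isBigO_eval_add_push_two {y : ℝ → Jet} {z : Jet} (hz : z ∈ Dom I)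
    (hy : Tendsto y (𝓝 0) (𝓝 z)) (P : DiffPoly) :
    (fun ε => eval F P (y ε + push F P₁ P₂ ε (y ε)) - (eval F P (y ε)
      + ε ^ 2 * eval F (ev P₁ P) (y ε))) =O[𝓝 0] fun ε => ε ^ 4 := by
  have h1 := isBigO_eval_add_push (P₁ := P₁) (P₂ := P₂) hI hF hz hy 2 P
  -- The ε⁴-part of the first-order Taylor term is moved into the remainder.
  have h2 := (isBigO_refl (fun ε : ℝ => ε ^ 4) (𝓝 0)).mul (isBigO_eval hI hF hz hy (ev P₂ P))
  simp only [mul_one] at h2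
  refine (h1.add h2).congr' ?_ .rfl
  filter_upwards [hy.eventually ((isOpen_dom hI).mem_nhds hz)] with ε hε
  simp only [Finset.sum_range_succ, Finset.sum_range_zero, dd_one hε.2, deval_push hε.2]
  simp [dd]
  ring

/-- Differentiation in x of a function evaluated along the jet of `w` is the total derivative.
Because `eval6` is truncated, the formula is exact in ε. -/
lemma jet_substitution (hV : Expands I F V P₁ P₂) {A : Set ℝ} (hA : IsOpen A) {w : ℝ → ℝ}
    (hw : ContDiffOn ℝ ∞ w A) (hD : ∀ x ∈ A, jet w x ∈ Dom I) (ε : ℝ) {x : ℝ} (hx : x ∈ A) :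
    jet (fun y => eval6 V ε (jet w y)) x = jet w x + push F P₁ P₂ ε (jet w x) := by
  have hP : ∀ (P : DiffPoly), ∀ x ∈ A, HasDerivAt (fun y => eval F P (jet w y))
      (eval F (total P) (jet w x)) x := fun P x hx => by
    rw [eval_total (hD x hx).2]
    exact hasDerivAt_eval hI hF (hasDerivAt_jet hA hw hx) (hD x hx) P
  have h1 : ∀ k, ∀ x ∈ A, iteratedDeriv k (fun y => eval6 V ε (jet w y)) x =
      jet w x k + push F P₁ P₂ ε (jet w x) k := by
    intro k
    induction k with
    | zero => intro x hx; exact hV ε _ (hD x hx)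
    | succ k ih =>
      intro x hx
      have h2 : iteratedDeriv k (fun y => eval6 V ε (jet w y)) =ᶠ[𝓝 x] fun y =>
          jet w y k + push F P₁ P₂ ε (jet w y) k := by
        filter_upwards [hA.mem_nhds hx] with y hy using ih y hy
      rw [iteratedDeriv_succ, h2.deriv_eq]
      simp only [push, Function.iterate_succ_apply']
      exact ((hasDerivAt_jet hA hw hx k).add (((hP _ x hx).const_mul _).add
        ((hP _ x hx).const_mul _))).deriv
  ext k
  exact h1 k x hx

/-- Two substitutions whose composition is the identity up to `O(ε⁶)`. -/
lemma substitution_inverse (hV : Expands I F V P₁ P₂) (hV' : Expands I F V' P₁' P₂')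
    (h₁ : ∀ z ∈ Dom I, eval F P₁ z + eval F P₁' z = 0)
    (h₂ : ∀ z ∈ Dom I, eval F P₂ z + eval F (ev P₁ P₁') z + eval F P₂' z = 0)
    {A : Set ℝ} (hA : IsOpen A) {w : ℝ → ℝ}
    (hw : ContDiffOn ℝ ∞ w A) (hD : ∀ x ∈ A, jet w x ∈ Dom I) {x : ℝ} (hx : x ∈ A) :
    (fun ε => eval6 V' ε (jet (fun y => eval6 V ε (jet w y)) x) - w x)
      =O[𝓝 0] fun ε : ℝ => ε ^ 6 := by
  have hz := hD x hx
  have hy : Tendsto (fun _ : ℝ => jet w x) (𝓝 0) (𝓝 (jet w x)) := tendsto_const_nhds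
  have hr (m : ℕ) := isBigO_refl (fun ε : ℝ => ε ^ m) (𝓝 0)
  -- The prefactors ε² and ε⁴ lower the required precision: the first coefficient is expanded up to
  -- O(ε⁴), the second up to O(ε²).
  have h3 := (hr 2).mul (isBigO_eval_add_push_two (P₁ := P₁) (P₂ := P₂) hI hF hz hy P₁')
  have h4 := (hr 4).mul (isBigO_eval_add_push_one (P₁ := P₁) (P₂ := P₂) hI hF hz hy P₂')
  simp only [← pow_add] at h3 h4
  refine (h3.add h4).congr' ?_ .rfl
  filter_upwards [(tendsto_add_push hI hF hz hy).eventually ((isOpen_dom hI).mem_nhds hz)] with ε hε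
  rw [jet_substitution hI hF hV hA hw hD ε hx, hV' ε _ hε]
  have h5 : w x = jet w x 0 := by simp [jet]
  have h6 : push F P₁ P₂ ε (jet w x) 0 =
    ε ^ 2 * eval F P₁ (jet w x) + ε ^ 4 * eval F P₂ (jet w x) := rfl
  rw [h5, Pi.add_apply, h6]
  linear_combination (-ε ^ 2) * h₁ _ hz - ε ^ 4 * h₂ _ hz

end

/-! ### Families of solutions -/

/-- Differentiation along `Ω` preserves the order in `ε` of a function that is smooth
near `{0} × Ω`. -/
lemma isBigO_pdir {E : Type*} [NormedAddCommGroup E] [NormedSpace ℝ E] {O : Set (ℝ × E)}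
    (hO : IsOpen O) {Ω : Set E} (hΩ : IsOpen Ω) (hOΩ : ∀ q ∈ Ω, ((0 : ℝ), q) ∈ O) {R : ℝ × E → ℝ}
    (hR : ContDiffOn ℝ ∞ R O) (n : ℕ) (e : E)
    (h : ∀ q ∈ Ω, (fun ε => R (ε, q)) =O[𝓝 0] fun ε : ℝ => ε ^ n) :
    ∀ q ∈ Ω, (fun ε => pdir (0, e) R (ε, q)) =O[𝓝 0] fun ε : ℝ => ε ^ n := by
  have hγ : ∀ (q : E) (t : ℝ), HasDerivAt (fun ε : ℝ => (ε, q)) ((1 : ℝ), (0 : E)) t :=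
    fun q t => (hasDerivAt_id' t).prodMk (hasDerivAt_const t q)
  have hU : ∀ q : E, IsOpen {ε : ℝ | (ε, q) ∈ O} := fun q =>
    hO.preimage (continuous_id.prodMk continuous_const)
  have hsm : ∀ (q : E) (S : ℝ × E → ℝ), ContDiffOn ℝ ∞ S O →
      ContDiffOn ℝ ∞ (fun ε => S (ε, q)) {ε : ℝ | (ε, q) ∈ O} := fun q S hS =>
    hS.comp (contDiff_id.prodMk contDiff_const).contDiffOn fun ε hε => hε
  -- The ε-derivatives of order < n vanish at ε = 0 on all of Ω. As Ω is open, their derivatives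
  -- along Ω vanish too, and these commute with the ε-derivatives.
  have hvan : ∀ j < n, ∀ q ∈ Ω, (pdir (1, 0))^[j] R (0, q) = 0 := by
    intro j hj q hq
    rw [← iteratedDeriv_eq_pdir hO hR (hγ q) j 0 (hOΩ q hq)]
    exact (isBigO_pow_iff (hU q) (hOΩ q hq) (hsm q R hR) n).1 (h q hq) j hj
  intro q hq
  have hR' := contDiffOn_pdir hO hR (0, e)
  rw [isBigO_pow_iff (hU q) (hOΩ q hq) (hsm q _ hR') n]
  intro j hj
  rw [iteratedDeriv_eq_pdir hO hR' (hγ q) j 0 (hOΩ q hq),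
    pdir_iterate_comm hO hR _ _ j _ (hOΩ q hq)]
  have h1 : HasDerivAt (fun t : ℝ => ((0 : ℝ), q + t • e)) ((0 : ℝ), e) 0 :=
    (hasDerivAt_const _ _).prodMk (by simpa using ((hasDerivAt_id' (0 : ℝ)).smul_const e).const_add q)
  have h2 := hasDerivAt_pdir hO (contDiffOn_pdir_iterate hO hR (1, 0) j) (t := 0)
    (by simpa using hOΩ q hq) h1
  have h3 : (fun t : ℝ => (pdir (1, 0))^[j] R (0, q + t • e)) =ᶠ[𝓝 0] fun _ => 0 := by
    have h4 : ContinuousAt (fun t : ℝ => q + t • e) 0 := by fun_prop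
    filter_upwards [h4.preimage_mem_nhds (hΩ.mem_nhds (by simpa using hq))] with t ht
      using hvan j hj _ ht
  have h5 := h2.unique ((hasDerivAt_const (0 : ℝ) (0 : ℝ)).congr_of_eventuallyEq h3)
  simpa using h5

/-- A family as a function of three variables. -/
def uncurry3 (w : ℝ → ℝ → ℝ → ℝ) : ℝ × ℝ × ℝ → ℝ := fun r => w r.1 r.2.1 r.2.2

/-- The `x`-jet of a family. -/
def jet3 (w : ℝ → ℝ → ℝ → ℝ) (r : ℝ × ℝ × ℝ) : Jet :=
  fun k => (pdir (0, 1, 0))^[k] (uncurry3 w) r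

lemma hasDerivAt_line_x (ε s t : ℝ) :
    HasDerivAt (fun y : ℝ => ((ε, y, s) : ℝ × ℝ × ℝ)) (0, 1, 0) t :=
  (hasDerivAt_const _ _).prodMk ((hasDerivAt_id' t).prodMk (hasDerivAt_const _ _))

lemma hasDerivAt_line_s (ε x t : ℝ) :
    HasDerivAt (fun σ : ℝ => ((ε, x, σ) : ℝ × ℝ × ℝ)) (0, 0, 1) t :=
  (hasDerivAt_const _ _).prodMk ((hasDerivAt_const _ _).prodMk (hasDerivAt_id' t))

lemma jet_eq_jet3 {O : Set (ℝ × ℝ × ℝ)} (hO : IsOpen O) {w : ℝ → ℝ → ℝ → ℝ}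
    (hw : ContDiffOn ℝ ∞ (uncurry3 w) O) {ε x s : ℝ} (h : (ε, x, s) ∈ O) :
    jet (fun y => w ε y s) x = jet3 w (ε, x, s) := by
  ext k
  exact iteratedDeriv_eq_pdir hO hw (hasDerivAt_line_x ε s) k x h

/-- Having value in `I` and nonzero x-derivative is an open condition, so it persists from ε = 0 to
a neighbourhood of {0} × Ω. -/
lemma IsMonotoneFamily.exists_open (hI : IsOpen I) {Ω : Set (ℝ × ℝ)} {w : ℝ → ℝ → ℝ → ℝ}
    (hw : IsMonotoneFamily I Ω w) : ∃ O : Set (ℝ × ℝ × ℝ), IsOpen O ∧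
      (∀ q ∈ Ω, ((0 : ℝ), q) ∈ O) ∧ ContDiffOn ℝ ∞ (uncurry3 w) O ∧ ∀ r ∈ O, jet3 w r ∈ Dom I := by
  obtain ⟨⟨U, hU, hUΩ, hwU⟩, hw0⟩ := hw
  have hwU : ContDiffOn ℝ ∞ (uncurry3 w) U := hwU
  have h1 := hwU.continuousOn.isOpen_inter_preimage hU hI
  have h2 := (contDiffOn_pdir hU hwU (0, 1, 0)).continuousOn.isOpen_inter_preimage hU
    (isOpen_ne (x := (0 : ℝ)))
  refine ⟨_, h1.inter h2, ?_, hwU.mono fun r hr => hr.1.1, fun r hr => ⟨hr.1.2, hr.2.2⟩⟩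
  rintro ⟨x, s⟩ hq
  refine ⟨⟨hUΩ _ hq, (hw0 x s hq).1⟩, hUΩ _ hq, ?_⟩
  have h3 := hasDerivAt_pdir hU hwU (t := x) (hUΩ _ hq) (hasDerivAt_line_x 0 s x)
  have h4 := (hw0 x s hq).2
  rwa [show (fun y => w 0 y s) = fun y => uncurry3 w (0, y, s) from rfl, h3.deriv] at h4

section
variable (hI : IsOpen I) (hF : ∀ i, ContDiffOn ℝ ∞ (F i) I)
variable {O : Set (ℝ × ℝ × ℝ)} (hO : IsOpen O) {w : ℝ → ℝ → ℝ → ℝ}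
  (hw : ContDiffOn ℝ ∞ (uncurry3 w) O) (hD : ∀ r ∈ O, jet3 w r ∈ Dom I)

include hO hw

lemma hasDerivAt_jet3_x {ε x s : ℝ} (h : (ε, x, s) ∈ O) (k : ℕ) :
    HasDerivAt (fun y => jet3 w (ε, y, s) k) (jet3 w (ε, x, s) (k + 1)) x := by
  have h1 := hasDerivAt_pdir hO (contDiffOn_pdir_iterate hO hw (0, 1, 0) k) (t := x) h
    (hasDerivAt_line_x ε s x)
  simpa only [jet3, Function.iterate_succ_apply'] using h1

include hI hF hD

lemma hasDerivAt_eval_jet3_x {ε x s : ℝ} (h : (ε, x, s) ∈ O) (P : DiffPoly) :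
    HasDerivAt (fun y => eval F P (jet3 w (ε, y, s))) (eval F (total P) (jet3 w (ε, x, s))) x := by
  rw [eval_total (hD _ h).2]
  exact hasDerivAt_eval hI hF (y := fun y => jet3 w (ε, y, s)) (hasDerivAt_jet3_x hO hw h) (hD _ h) P

lemma hasDerivAt_eval_jet3_s {ε x s : ℝ} (h : (ε, x, s) ∈ O) (P : DiffPoly) :
    HasDerivAt (fun σ => eval F P (jet3 w (ε, x, σ))) (deval F P (jet3 w (ε, x, s))
      fun k => pdir (0, 0, 1) ((pdir (0, 1, 0))^[k] (uncurry3 w)) (ε, x, s)) s :=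
  hasDerivAt_eval hI hF (y := fun σ => jet3 w (ε, x, σ)) (fun k =>
    hasDerivAt_pdir hO (contDiffOn_pdir_iterate hO hw (0, 1, 0) k) (t := s) h
      (hasDerivAt_line_s ε x s)) (hD _ h) P

/-- The residue of a family with respect to the equation `w_s + A₀ + ε² A₁ + ε⁴ A₂ = 0`. -/
def residue (F : ℕ → ℝ → ℝ) (A₀ A₁ A₂ : DiffPoly) (w : ℝ → ℝ → ℝ → ℝ) (r : ℝ × ℝ × ℝ) : ℝ :=
  pdir (0, 0, 1) (uncurry3 w) r + (eval F A₀ (jet3 w r) + push F A₁ A₂ r.1 (jet3 w r) 0)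

lemma contDiffOn_residue (A₀ A₁ A₂ : DiffPoly) : ContDiffOn ℝ ∞ (residue F A₀ A₁ A₂ w) O := by
  have h1 (P : DiffPoly) : ContDiffOn ℝ ∞ (fun r => eval F P (jet3 w r)) O :=
    contDiffOn_eval hI hF (fun k => contDiffOn_pdir_iterate hO hw _ k) hD P
  exact (contDiffOn_pdir hO hw _).add ((h1 A₀).add
    (((contDiff_fst.pow 2).contDiffOn.mul (h1 A₁)).add
      ((contDiff_fst.pow 4).contDiffOn.mul (h1 A₂))))

/-- The x-derivatives of the residue are the residues of the prolonged equations, because ∂_s and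
∂_x commute. They thus determine the s-derivative of the whole jet. -/
lemma pdir_residue (A₀ A₁ A₂ : DiffPoly) (k : ℕ) : ∀ r ∈ O,
    (pdir (0, 1, 0))^[k] (residue F A₀ A₁ A₂ w) r =
      pdir (0, 0, 1) ((pdir (0, 1, 0))^[k] (uncurry3 w)) r
        + (eval F (total^[k] A₀) (jet3 w r) + push F A₁ A₂ r.1 (jet3 w r) k) := by
  have hR := contDiffOn_residue hI hF hO hw hD A₀ A₁ A₂
  induction k with
  | zero => intro r _; rfl
  | succ k ih =>
    rintro ⟨ε, x, s⟩ hr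
    have hk := contDiffOn_pdir_iterate hO hw (0, 1, 0) k
    have h1 := hasDerivAt_pdir hO (contDiffOn_pdir_iterate hO hR (0, 1, 0) k) (t := x) hr
      (hasDerivAt_line_x ε s x)
    have h2 := hasDerivAt_pdir hO (contDiffOn_pdir hO hk (0, 0, 1)) (t := x) hr
      (hasDerivAt_line_x ε s x)
    have h3 (P : DiffPoly) := hasDerivAt_eval_jet3_x hI hF hO hw hD hr P
    have h4 := h2.add ((h3 (total^[k] A₀)).add (((h3 (total^[k] A₁)).const_mul (ε ^ 2)).add
      ((h3 (total^[k] A₂)).const_mul (ε ^ 4))))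
    have h5 := h1.unique (h4.congr_of_eventuallyEq ?_)
    · rw [Function.iterate_succ_apply', h5, pdir_comm hO hk _ _ _ hr]
      simp only [push, Function.iterate_succ_apply']
    · filter_upwards [(hasDerivAt_line_x ε s x).continuousAt.preimage_mem_nhds
        (hO.mem_nhds hr)] with y hy using ih _ hy

end

end

section

open DiffPoly

/-! ### Transport of approximate solutions by a substitution. -/

lemma isBigO_one_mul {α : Type*} {l : Filter α} {f g : α → ℝ} (hf : f =O[l] fun _ => (1 : ℝ))
    (hg : g =O[l] fun _ => (1 : ℝ)) : (fun a => f a * g a) =O[l] fun _ => (1 : ℝ) := by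
  simpa only [mul_one] using hf.mul hg

/-- The right-hand side `f''(u) u_x` of the unperturbed equation, for `f = F 3`. -/
def transport : DiffPoly := [(1, 1, [13])]

/-- The term `½ f'''' u_x P² + f''' P ∂_x P` in the expansion of `f''(u) u_x` at `u + P`. -/
def transportHess (P : DiffPoly) : DiffPoly :=
  add (smul (1 / 2) (mul (fn 3 4) (mul (var 1) (mul P P)))) (mul (fn 3 3) (mul P (total P)))

variable {I : Set ℝ} {F : ℕ → ℝ → ℝ} {V : EpsFun} {P₁ P₂ A₁ A₂ B₁ B₂ : DiffPoly}

lemma eval_transport (z : Jet) : eval F transport z = iteratedDeriv 2 (F 3) (z 0) * z 1 := by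
  simp [transport, gen, mul_comm]

lemma eval_transportHess {z : Jet} (hz : z 1 ≠ 0) (P : DiffPoly) :
    eval F (transportHess P) z = 1 / 2 * (iteratedDeriv 4 (F 3) (z 0) * z 1 * eval F P z ^ 2)
      + iteratedDeriv 3 (F 3) (z 0) * eval F P z * eval F (total P) z := by
  simp only [transportHess, eval_add, eval_smul hz, eval_mul hz, eval_var_succ,
    eval_fn (i := 3) (by decide)]
  norm_num
  ring

lemma dd_two_transport {z : Jet} (hz : z 1 ≠ 0) (h : Jet) :
    dd F 2 transport z h = iteratedDeriv 4 (F 3) (z 0) * z 1 * h 0 ^ 2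
      + 2 * (iteratedDeriv 3 (F 3) (z 0) * h 0 * h 1) := by
  have h0 : pd 0 transport = [(1, 1, [18])] := by decide +kernel
  have h1 : pd 1 transport = [(1, 0, [13])] := by decide +kernel
  have h2 : pd 2 transport = [] := by decide +kernel
  have h3 : pd 3 transport = [] := by decide +kernel
  have h4 : pd 4 transport = [] := by decide +kernel
  -- The bound counts generator 13, that is f'', as if it were a jet variable of order 4; this is
  -- why the vanishing partial derivatives of index 2 to 4 appear.
  have h5 : ord transport = 5 := by decide +kernel
  have h6 : dd F 2 transport z h = ∑ k ∈ Finset.range 5, h k * deval F (pd k transport) z h := by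
    rw [← h5]
    exact Finset.sum_congr rfl fun k _ => by rw [← dd_one hz]
  rw [h6]
  simp [Finset.sum_range_succ, h0, h1, h2, h3, h4, dmon, dgen, gen]
  ring

section
variable (hI : IsOpen I) (hF : ∀ i, ContDiffOn ℝ ∞ (F i) I)
include hI hF

lemma isBigO_transport_add_push {y : ℝ → Jet} {z : Jet} (hz : z ∈ Dom I)
    (hy : Tendsto y (𝓝 0) (𝓝 z)) :
    (fun ε => eval F transport (y ε + push F P₁ P₂ ε (y ε)) - (eval F transport (y ε)
      + ε ^ 2 * eval F (ev P₁ transport) (y ε)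
      + ε ^ 4 * (eval F (ev P₂ transport) (y ε) + eval F (transportHess P₁) (y ε))))
      =O[𝓝 0] fun ε => ε ^ 6 := by
  have h1 := isBigO_eval_add_push (P₁ := P₁) (P₂ := P₂) hI hF hz hy 3 transport
  have hb (P : DiffPoly) := isBigO_eval hI hF hz hy P
  have hr (m : ℕ) := isBigO_refl (fun ε : ℝ => ε ^ m) (𝓝 0)
  have hε : (fun ε : ℝ => ε ^ 2) =O[𝓝 0] fun _ => (1 : ℝ) :=
    (continuous_pow 2).continuousAt.tendsto.isBigO_one ℝ
  have hm {f g : ℝ → ℝ} := isBigO_one_mul (l := 𝓝 0) (f := f) (g := g)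
  -- These are the contributions of order ε⁶ and higher to half the second derivative in the
  -- direction ε² P₁ + ε⁴ P₂; its ε⁴-part is `transportHess P₁`.
  have h2 := (hr 6).mul ((hm (hb (mul (fn 3 4) (var 1))) ((hm (hb P₁) (hb P₂)).add
    ((hm hε (hm (hb P₂) (hb P₂))).const_mul_left (1 / 2)))).add
      (hm (hb (fn 3 3)) (((hm (hb P₁) (hb (total P₂))).add (hm (hb P₂) (hb (total P₁)))).add
        (hm hε (hm (hb P₂) (hb (total P₂)))))))
  simp only [mul_one] at h2
  refine (h1.add h2).congr' ?_ .rfl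
  filter_upwards [hy.eventually ((isOpen_dom hI).mem_nhds hz)] with ε hε
  simp only [Finset.sum_range_succ, Finset.sum_range_zero, dd_one hε.2, deval_push hε.2,
    dd_two_transport hε.2, eval_transportHess hε.2, eval_mul hε.2, eval_var_succ,
    eval_fn (i := 3) (by decide)]
  simp [dd, push]
  ring

lemma isBigO_deval {y : ℝ → Jet} {z : Jet} (hz : z ∈ Dom I) (hy : Tendsto y (𝓝 0) (𝓝 z))
    {ρ : ℝ → Jet} {g : ℝ → ℝ} (hρ : ∀ k, (fun ε => ρ ε k) =O[𝓝 0] g) (P : DiffPoly) :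
    (fun ε => deval F P (y ε) (ρ ε)) =O[𝓝 0] g := by
  have h1 := isBigO_dd hI hF hz hy hρ 1 P
  simp only [pow_one] at h1
  refine h1.congr' ?_ .rfl
  filter_upwards [hy.eventually ((isOpen_dom hI).mem_nhds hz)] with ε hε using dd_one hε.2 P _

/-- A substitution maps solutions modulo `O(ε⁶)` of `w_s + f''(w) w_x + ε² A₁ + ε⁴ A₂ = 0` to
solutions modulo `O(ε⁶)` of the equation with `B₁`, `B₂` in place of `A₁`, `A₂`. -/
theorem substitution_solves {Ω : Set (ℝ × ℝ)} (hΩ : IsOpen Ω) {w : ℝ → ℝ → ℝ → ℝ}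
    (hw : IsMonotoneFamily I Ω w) (hV : Expands I F V P₁ P₂) {a b : ℝ → JetFun}
    (ha : ∀ ε, ∀ z ∈ Dom I, a ε z = eval F transport z + push F A₁ A₂ ε z 0)
    (hb : ∀ ε, ∀ z ∈ Dom I, b ε z = eval F transport z + push F B₁ B₂ ε z 0)
    (h₁ : ∀ z ∈ Dom I, eval F A₁ z + eval F (ev transport P₁) z =
      eval F (ev P₁ transport) z + eval F B₁ z)
    (h₂ : ∀ z ∈ Dom I, eval F A₂ z + eval F (ev A₁ P₁) z + eval F (ev transport P₂) z =
      eval F (ev P₂ transport) z + eval F (transportHess P₁) z + eval F (ev P₁ B₁) z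
        + eval F B₂ z)
    (hsol : ∀ x s, (x, s) ∈ Ω →
      (fun ε => deriv (fun σ => w ε x σ) s + a ε (jet (fun y => w ε y s) x))
        =O[𝓝 0] fun ε : ℝ => ε ^ 6) :
    ∀ x s, (x, s) ∈ Ω →
      (fun ε => deriv (fun σ => substitute V w ε x σ) s
        + b ε (jet (fun y => substitute V w ε y s) x)) =O[𝓝 0] fun ε : ℝ => ε ^ 6 := by
  obtain ⟨O, hO, hOΩ, hwO, hD⟩ := hw.exists_open hI
  have hR := contDiffOn_residue hI hF hO hwO hD transport A₁ A₂
  have hnear : ∀ q ∈ Ω, ∀ᶠ ε : ℝ in 𝓝 0, (ε, q) ∈ O := fun q hq =>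
    (Continuous.prodMk continuous_id continuous_const).continuousAt.preimage_mem_nhds
      (hO.mem_nhds (hOΩ q hq))
  -- The hypothesis bounds the residue alone, but differentiating P₁ and P₂ in s involves the
  -- s-derivatives of all jet variables, hence the residue's x-derivatives.
  have hRk : ∀ k, ∀ q ∈ Ω, (fun ε => (pdir (0, 1, 0))^[k] (residue F transport A₁ A₂ w) (ε, q))
      =O[𝓝 0] fun ε : ℝ => ε ^ 6 := by
    intro k
    induction k with
    | zero =>
      rintro ⟨x, s⟩ hq
      refine (hsol x s hq).congr' ?_ .rfl
      filter_upwards [hnear _ hq] with ε hε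
      have h1 := hasDerivAt_pdir hO hwO (t := s) hε (hasDerivAt_line_s ε x s)
      rw [show (fun σ => w ε x σ) = fun σ => uncurry3 w (ε, x, σ) from rfl, h1.deriv,
        jet_eq_jet3 hO hwO hε, ha ε _ (hD _ hε)]
      rfl
    | succ k ih =>
      simp only [Function.iterate_succ_apply']
      exact isBigO_pdir hO hΩ hOΩ (contDiffOn_pdir_iterate hO hR _ k) 6 (1, 0) ih
  intro x s hq
  set ζ : ℝ → Jet := fun ε => jet3 w (ε, x, s) with hζ
  set ρ : ℝ → Jet := fun ε k => (pdir (0, 1, 0))^[k] (residue F transport A₁ A₂ w) (ε, x, s) with hρ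
  have hz : ζ 0 ∈ Dom I := hD _ (hOΩ _ hq)
  have hy : Tendsto ζ (𝓝 0) (𝓝 (ζ 0)) := by
    refine tendsto_pi_nhds.2 fun k => ?_
    have h1 := ((contDiffOn_pdir_iterate hO hwO (0, 1, 0) k).continuousOn.continuousAt
      (hO.mem_nhds (hOΩ _ hq)))
    exact h1.tendsto.comp (Continuous.tendsto' (f := fun ε : ℝ => (ε, x, s)) (by fun_prop) _ _ rfl)
  have hρO (k : ℕ) : (fun ε => ρ ε k) =O[𝓝 0] fun ε : ℝ => ε ^ 6 := hRk k _ hq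
  have hbd (P : DiffPoly) := isBigO_eval hI hF hz hy P
  have hr (m : ℕ) := isBigO_refl (fun ε : ℝ => ε ^ m) (𝓝 0)
  have hone (m : ℕ) : (fun ε : ℝ => ε ^ m) =O[𝓝 0] fun _ => (1 : ℝ) :=
    (continuous_pow m).continuousAt.tendsto.isBigO_one ℝ
  have hd1 := (hone 2).mul (isBigO_deval hI hF hz hy hρO P₁)
  have hd2 := (hone 4).mul (isBigO_deval hI hF hz hy hρO P₂)
  have hX := isBigO_transport_add_push (P₁ := P₁) (P₂ := P₂) hI hF hz hy
  have hB1 := (hr 2).mul (isBigO_eval_add_push_two (P₁ := P₁) (P₂ := P₂) hI hF hz hy B₁)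
  have hB2 := (hr 4).mul (isBigO_eval_add_push_one (P₁ := P₁) (P₂ := P₂) hI hF hz hy B₂)
  -- The cross terms of ε² P₁ + ε⁴ P₂ with ε² A₁ + ε⁴ A₂ that have order at least 6.
  have hrest := (hr 6).mul (((hbd (ev A₂ P₁)).add (hbd (ev A₁ P₂))).add
    (isBigO_one_mul (hone 2) (hbd (ev A₂ P₂))))
  simp only [← pow_add, one_mul, mul_one] at hd1 hd2 hB1 hB2 hrest
  refine (((((((hρO 0).add hd1).add hd2).add hX).add hB1).add hB2).sub hrest).congr' ?_ .rfl
  filter_upwards [hnear _ hq,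
    (tendsto_add_push (P₁ := P₁) (P₂ := P₂) hI hF hz hy).eventually
      ((isOpen_dom hI).mem_nhds hz)] with ε hε hdom
  have hζD : ζ ε ∈ Dom I := hD _ hε
  have hlineS : ∀ᶠ σ in 𝓝 s, (ε, x, σ) ∈ O :=
    (hasDerivAt_line_s ε x s).continuousAt.preimage_mem_nhds (hO.mem_nhds hε)
  have hopenX : IsOpen {y : ℝ | (ε, y, s) ∈ O} := hO.preimage (by fun_prop)
  have hjet : jet (fun y => substitute V w ε y s) x = ζ ε + push F P₁ P₂ ε (ζ ε) := by
    have h1 := jet_substitution hI hF hV hopenX (w := fun y => w ε y s)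
      (hwO.comp (f := fun y : ℝ => ((ε, y, s) : ℝ × ℝ × ℝ)) (by fun_prop) fun y hy => hy)
      (fun y hy => by rw [jet_eq_jet3 hO hwO hy]; exact hD _ hy) ε (x := x) hε
    rw [jet_eq_jet3 hO hwO hε] at h1
    exact h1
  set h : Jet := fun k => pdir (0, 0, 1) ((pdir (0, 1, 0))^[k] (uncurry3 w)) (ε, x, s) with hh
  have hS (P : DiffPoly) : HasDerivAt (fun σ => eval F P (jet3 w (ε, x, σ)))
    (deval F P (ζ ε) h) s := hasDerivAt_eval_jet3_s hI hF hO hwO hD hε P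
  have hderiv : deriv (fun σ => substitute V w ε x σ) s =
      h 0 + (ε ^ 2 * deval F P₁ (ζ ε) h + ε ^ 4 * deval F P₂ (ζ ε) h) := by
    have h1 := (hasDerivAt_pdir hO hwO (t := s) hε (hasDerivAt_line_s ε x s)).add
      (((hS P₁).const_mul (ε ^ 2)).add ((hS P₂).const_mul (ε ^ 4)))
    refine (h1.congr_of_eventuallyEq ?_).deriv
    filter_upwards [hlineS] with σ hσ
    rw [substitute, jet_eq_jet3 hO hwO hσ, hV ε _ (hD _ hσ)]
    rfl
  -- The prolonged equation solved for the s-derivative of the jet, up to the small residues `ρ`.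
  have hhρ : h = ((ρ ε + (-1 : ℝ) • fun k => eval F (total^[k] transport) (ζ ε))
      + (-1 : ℝ) • push F A₁ A₂ ε (ζ ε)) := by
    ext k
    have h1 := pdir_residue hI hF hO hwO hD transport A₁ A₂ k _ hε
    simp only [hρ, hh, Pi.add_apply, Pi.smul_apply, smul_eq_mul, h1]
    ring
  have hdev (P : DiffPoly) : deval F P (ζ ε) h = deval F P (ζ ε) (ρ ε)
      - eval F (ev transport P) (ζ ε)
      - (ε ^ 2 * eval F (ev A₁ P) (ζ ε) + ε ^ 4 * eval F (ev A₂ P) (ζ ε)) := by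
    rw [hhρ, deval_add_smul, deval_add_smul, deval_push hζD.2, eval_ev hζD.2 transport]
    ring
  have hh0 : h 0 = ρ ε 0 - eval F transport (ζ ε)
      - (ε ^ 2 * eval F A₁ (ζ ε) + ε ^ 4 * eval F A₂ (ζ ε)) := by
    rw [hhρ]
    simp [push]
    ring
  have hp (z : Jet) : push F B₁ B₂ ε z 0 = ε ^ 2 * eval F B₁ z + ε ^ 4 * eval F B₂ z := rfl
  rw [hjet, hb ε _ hdom, hderiv, hdev, hdev, hh0, hp]
  linear_combination ε ^ 2 * h₁ _ hζD + ε ^ 4 * h₂ _ hζD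

end

end

section

open DiffPoly

/-! ### The differential polynomials of the theorem -/

namespace DiffPoly

local notation:65 P:65 "⊹" Q:66 => DiffPoly.add P Q
local notation:70 P:70 "⋇" Q:71 => DiffPoly.mul P Q

/-- The power `u_x ^ e`. -/
def upow (e : ℤ) : DiffPoly := [(1, e, [])]

/-- The coefficient of `ε` in the density of `K`. -/
def densityK₁ : DiffPoly := smul (1 / 24) (fn 1 0 ⋇ var 1 ⋇ [(1, 0, [4])])

/-- The coefficient of `ε³` in the density of `K`. -/
def densityK₃ : DiffPoly :=
  smul (1 / 5760) (fn 1 0 ⋇ fn 1 0 ⋇ (var 2 ⋇ var 2 ⋇ var 2 ⋇ upow (-3)))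
    ⊹ smul (-1 / 4) (fn 2 0 ⋇ (var 2 ⋇ var 2 ⋇ upow (-1)))

/-- The coefficient of `ε²` in the density of `H_f`. -/
def densityH₂ : DiffPoly := smul (-1 / 24) (fn 1 0 ⋇ fn 3 3 ⋇ (var 1 ⋇ var 1))

/-- The coefficient of `ε⁴` in the density of `H_f`. -/
def densityH₄ : DiffPoly :=
  (fn 2 0 ⋇ fn 3 3 ⊹ smul (1 / 480) (fn 1 0 ⋇ fn 1 0 ⋇ fn 3 4)) ⋇ (var 2 ⋇ var 2)
    ⊹ smul (-1) ((smul (1 / 1152) (fn 1 0 ⋇ fn 1 2 ⋇ fn 3 4)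
      ⊹ smul (1 / 1152) (fn 1 0 ⋇ fn 1 1 ⋇ fn 3 5)
      ⊹ smul (1 / 3456) (fn 1 0 ⋇ fn 1 0 ⋇ fn 3 6)
      ⊹ smul (1 / 6) (fn 2 1 ⋇ fn 3 4)
      ⊹ smul (1 / 6) (fn 2 0 ⋇ fn 3 5)
      ⊹ smul (-1 / 3456) (fn 1 0 ⋇ fn 1 3 ⋇ fn 3 3)) ⋇ (var 1 ⋇ var 1 ⋇ var 1 ⋇ var 1))

/-- The coefficient of `ε²` in the substitution, before `∂_x / 24`. -/
def quasiInner₂ : DiffPoly := fn 1 0 ⋇ (var 2 ⋇ upow (-1)) ⊹ fn 1 1 ⋇ var 1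

/-- The function under `∂_x` in the first term of `quasiBracket`. -/
def quasiInner₀ : DiffPoly :=
  smul (1 / 360) (var 2 ⋇ var 2 ⋇ var 2 ⋇ upow (-4))
    ⊹ smul (-7 / 1920) (var 2 ⋇ var 3 ⋇ upow (-3)) ⊹ smul (1 / 1152) (var 4 ⋇ upow (-2))

/-- The bracket under `∂_x` in the coefficient of `ε⁴` in the substitution. -/
def quasiInner₄ : DiffPoly :=
  fn 1 0 ⋇ fn 1 0 ⋇ total quasiInner₀
    ⊹ fn 1 0 ⋇ fn 1 1 ⋇ (smul (47 / 5760) (var 2 ⋇ var 2 ⋇ var 2 ⋇ upow (-3))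
      ⊹ smul (-37 / 2880) (var 2 ⋇ var 3 ⋇ upow (-2)) ⊹ smul (5 / 1152) (var 4 ⋇ upow (-1)))
    ⊹ fn 1 1 ⋇ fn 1 1 ⋇ (smul (1 / 384) (var 3) ⊹ smul (-1 / 5760) (var 2 ⋇ var 2 ⋇ upow (-1)))
    ⊹ fn 1 0 ⋇ fn 1 2 ⋇ (smul (1 / 144) (var 3) ⊹ smul (-1 / 360) (var 2 ⋇ var 2 ⋇ upow (-1)))
    ⊹ smul (1 / 1152) (smul 7 (fn 1 1 ⋇ fn 1 2 ⋇ (var 1 ⋇ var 2))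
      ⊹ fn 1 2 ⋇ fn 1 2 ⋇ (var 1 ⋇ var 1 ⋇ var 1)
      ⊹ smul 6 (fn 1 0 ⋇ fn 1 3 ⋇ (var 1 ⋇ var 2))
      ⊹ fn 1 1 ⋇ fn 1 3 ⋇ (var 1 ⋇ var 1 ⋇ var 1)
      ⊹ fn 1 0 ⋇ fn 1 4 ⋇ (var 1 ⋇ var 1 ⋇ var 1))
    ⊹ fn 2 0 ⋇ (smul (1 / 2) (var 2 ⋇ var 2 ⋇ var 2 ⋇ upow (-3))
      ⊹ smul (-1) (var 2 ⋇ var 3 ⋇ upow (-2)) ⊹ smul (1 / 2) (var 4 ⋇ upow (-1)))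
    ⊹ fn 2 1 ⋇ var 3
    ⊹ smul (1 / 2) (fn 2 2 ⋇ (var 1 ⋇ var 2))

/-- `∂_x δ/δu` -/
def ham (P : DiffPoly) : DiffPoly := total (eulerLagrange P)

/-- The coefficient of `ε⁴` of the canonical transformation generated by `ε P + ε³ Q`. -/
def can₄ (P Q : DiffPoly) : DiffPoly := ham Q ⊹ smul (1 / 2) (ev (ham P) (ham P))

/-- The coefficient of `ε²` in the substitution. -/
def quasi₂ : DiffPoly := smul (1 / 24) (total quasiInner₂)

/-- The coefficient of `ε⁴` in the substitution. -/
def quasi₄ : DiffPoly := total quasiInner₄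

/-- The difference of the coefficients of `ε²` in `h_f` and `f(v)` is the total derivative of
this function. -/
def primitive₂ : DiffPoly :=
  -- Integration by parts: with E = δK₁/δu one has f' ∂_x E = ∂_x(f' E) - f'' u_x E, and f'' u_x E
  -- joins the ε²-term of h_f to form -∂_x(c f'' u_x)/24.
  smul (-1) (fn 3 1 ⋇ eulerLagrange densityK₁) ⊹ smul (-1 / 24) (fn 1 0 ⋇ fn 3 2 ⋇ var 1)

/-- The difference of the coefficients of `ε⁴` in `h_f` and `f(v)` is the total derivative of
this function. -/
def primitive₄ : DiffPoly :=
  -- Evolutionary fields commute with ∂_x, so the ε⁴-coefficient of v is ∂_x Y with Y the sum inside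
  -- the brackets, and f' ∂_x Y is integrated by parts. The list that follows is a primitive of h₄ +
  -- f'' u_x Y - ½ f'' X₁², where h₄ is the ε⁴-term of h_f; its terms carry three x-derivatives and
  -- are quadratic in c or linear in p.
  smul (-1) (fn 3 1 ⋇ (eulerLagrange densityK₃
    ⊹ smul (1 / 2) (ev (ham densityK₁) (eulerLagrange densityK₁)))) ⊹
  [(7/5760, -3, [13, 1, 1, 0, 0, 0]),
   (1/2, -1, [13, 2, 0, 0]),
   (-7/2880, -2, [13, 5, 1, 1, 0]),
   (-1/2, 0, [13, 5, 2]),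
   (-1/640, -1, [13, 6, 1, 0, 0]),
   (1/384, 0, [13, 6, 5, 1]),
   (-1/2, 1, [13, 7, 0]),
   (1/1152, -1, [13, 10, 1, 1]),
   (1/384, 1, [13, 11, 1, 0]),
   (1/1152, 3, [16, 13, 1]),
   (7/5760, -1, [18, 1, 1, 0, 0]),
   (1/2, 1, [18, 2, 0]),
   (-1/1152, 0, [18, 5, 1, 1]),
   (-1/1152, 1, [18, 6, 1, 0]),
   (1/3456, 3, [18, 6, 6]),
   (-1/1728, 3, [18, 11, 1]),
   (1/1152, 1, [23, 1, 1, 0]),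
   (-1/6, 3, [23, 2]),
   (-1/3456, 3, [23, 6, 1]),
   (-1/3456, 3, [28, 1, 1])]

/-! ### The identities, verified by computation. -/

lemma same_densityH₂ :
    same (densityH₂ ⊹ smul (-1) (fn 3 1 ⋇ ham densityK₁)) (total primitive₂) = true := by
  decide +kernel

/-- The choice s = c c'''/3456 is forced here: another s would change the left-hand side by a
multiple of f''' u_x⁴, and a nonzero density g(u) u_x⁴ is never a total derivative. -/
lemma same_densityH₄ : same (densityH₄ ⊹ smul (-1) (fn 3 1 ⋇ can₄ densityK₁ densityK₃ ⊹
    smul (1 / 2) (fn 3 2 ⋇ (ham densityK₁ ⋇ ham densityK₁)))) (total primitive₄) = true := by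
  decide +kernel

lemma same_quasi₂ : same (ham (smul (-1) densityK₁)) quasi₂ = true := by
  decide +kernel

lemma same_quasi₄ : same (can₄ (smul (-1) densityK₁) (smul (-1) densityK₃)) quasi₄ = true := by
  decide +kernel

lemma same_inverse₂ : same (ham densityK₁ ⊹ quasi₂) [] = true := by
  decide +kernel

/-- The ε⁴-term of exp(K) followed by exp(-K): (X₃ + ½ X₁·X₁) - X₁·X₁ + (-X₃ + ½ X₁·X₁) = 0. -/
lemma same_inverse₄ :
    same (can₄ densityK₁ densityK₃ ⊹ ev (ham densityK₁) quasi₂ ⊹ quasi₄) [] = true := by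
  decide +kernel

lemma same_inverse₄' :
    same (quasi₄ ⊹ ev quasi₂ (ham densityK₁) ⊹ can₄ densityK₁ densityK₃) [] = true := by
  decide +kernel

lemma same_transport : same (ham (fn 3 0)) transport = true := by
  decide +kernel

/-- At order ε², conjugating the flow of ∫f by the transformation adds the commutator of f'' u_x
with the ε²-coefficient of the substitution, which has to be the field of the ε²-term of H_f. The
further identities say the same for the inverse and at order ε⁴. -/
lemma same_solves₂ : same (ev transport quasi₂) (ev quasi₂ transport ⊹ ham densityH₂) = true := by
  decide +kernel

lemma same_solves₂' :
    same (ham densityH₂ ⊹ ev transport (ham densityK₁)) (ev (ham densityK₁) transport) = true := by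
  decide +kernel

lemma same_solves₄ : same (ev transport quasi₄)
    (ev quasi₄ transport ⊹ transportHess quasi₂ ⊹ ev quasi₂ (ham densityH₂) ⊹ ham densityH₄) = true := by
  decide +kernel

lemma same_solves₄' :
    same (ham densityH₄ ⊹ ev (ham densityH₂) (ham densityK₁) ⊹ ev transport (can₄ densityK₁ densityK₃))
    (ev (can₄ densityK₁ densityK₃) transport ⊹ transportHess (ham densityK₁)) = true := by
  decide +kernel

end DiffPoly

end

section

open DiffPoly

/-! ### The theorem -/

/-- The functions `c`, `p`, `f` as the coefficient functions of differential polynomials. -/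
def env (c p f : ℝ → ℝ) : ℕ → ℝ → ℝ
  | 1 => c
  | 2 => p
  | 3 => f
  | _ => 0

variable {I : Set ℝ} {c p f : ℝ → ℝ}

lemma contDiffOn_env (hc : ContDiffOn ℝ ∞ c I) (hp : ContDiffOn ℝ ∞ p I)
    (hf : ContDiffOn ℝ ∞ f I) : ∀ i, ContDiffOn ℝ ∞ (env c p f i) I
  | 0 => contDiffOn_const
  | 1 => hc
  | 2 => hp
  | 3 => hf
  | _ + 4 => contDiffOn_const

@[simp] lemma eval_fn_one (j : ℕ) (z : Jet) :
    eval (env c p f) (fn 1 j) z = iteratedDeriv j c (z 0) := eval_fn (by decide) j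

@[simp] lemma eval_fn_two (j : ℕ) (z : Jet) :
    eval (env c p f) (fn 2 j) z = iteratedDeriv j p (z 0) := eval_fn (by decide) j

@[simp] lemma eval_fn_three (j : ℕ) (z : Jet) :
    eval (env c p f) (fn 3 j) z = iteratedDeriv j f (z 0) := eval_fn (by decide) j

@[simp] lemma eval_upow (e : ℤ) (z : Jet) : eval (env c p f) (upow e) z = z 1 ^ e := by
  simp [upow]

lemma densityK_eq (c p : ℝ → ℝ) : densityK c p =
    odd3 (fun z => 1 / 24 * c (z 0) * z 1 * Real.log (z 1)) fun z =>
      c (z 0) ^ 2 / 5760 * (z 2 ^ 3 / z 1 ^ 3) - p (z 0) / 4 * (z 2 ^ 2 / z 1) := rfl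

lemma neg_odd3 (g h : JetFun) : -odd3 g h = odd3 (-g) (-h) := by
  simp only [odd3, map_neg, neg_add]

lemma eval_var_one (F : ℕ → ℝ → ℝ) (z : Jet) : eval F (var 1) z = z 1 := eval_var_succ 0
lemma eval_var_two (F : ℕ → ℝ → ℝ) (z : Jet) : eval F (var 2) z = z 2 := eval_var_succ 1
lemma eval_var_three (F : ℕ → ℝ → ℝ) (z : Jet) : eval F (var 3) z = z 3 := eval_var_succ 2
lemma eval_var_four (F : ℕ → ℝ → ℝ) (z : Jet) : eval F (var 4) z = z 4 := eval_var_succ 3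

lemma zpow_neg_literals (x : ℝ) : x ^ (-1 : ℤ) = x⁻¹ ∧ x ^ (-2 : ℤ) = (x ^ 2)⁻¹ ∧
    x ^ (-3 : ℤ) = (x ^ 3)⁻¹ ∧ x ^ (-4 : ℤ) = (x ^ 4)⁻¹ :=
  ⟨zpow_neg_one x, zpow_neg x 2, zpow_neg x 3, zpow_neg x 4⟩

lemma represents_densityK₁ : Represents I (env c p f) densityK₁
    fun z => 1 / 24 * c (z 0) * z 1 * Real.log (z 1) := fun z hz => by
  simp only [densityK₁, eval_smul hz.2, eval_mul hz.2, eval_fn_one, eval_var_one,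
    iteratedDeriv_zero]
  simp [gen]
  ring

lemma represents_densityK₃ : Represents I (env c p f) densityK₃ fun z =>
    c (z 0) ^ 2 / 5760 * (z 2 ^ 3 / z 1 ^ 3) - p (z 0) / 4 * (z 2 ^ 2 / z 1) := fun z hz => by
  simp only [densityK₃, eval_add, eval_smul hz.2, eval_mul hz.2, eval_fn_one, eval_fn_two,
    eval_var_two, eval_upow, iteratedDeriv_zero, zpow_neg_literals]
  push_cast
  ring

lemma represents_densityH₂ : Represents I (env c p f) densityH₂ fun z =>
    -(1 / 24) * c (z 0) * iteratedDeriv 3 f (z 0) * z 1 ^ 2 := fun z hz => by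
  simp only [densityH₂, eval_smul hz.2, eval_mul hz.2, eval_fn_one, eval_fn_three, eval_var_one,
    iteratedDeriv_zero]
  push_cast
  ring

lemma represents_densityH₄ : Represents I (env c p f) densityH₄ fun z =>
    (p (z 0) * iteratedDeriv 3 f (z 0) + c (z 0) ^ 2 * iteratedDeriv 4 f (z 0) / 480) * z 2 ^ 2
    - (c (z 0) * iteratedDeriv 2 c (z 0) * iteratedDeriv 4 f (z 0) / 1152
      + c (z 0) * iteratedDeriv 1 c (z 0) * iteratedDeriv 5 f (z 0) / 1152
      + c (z 0) ^ 2 * iteratedDeriv 6 f (z 0) / 3456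
      + iteratedDeriv 1 p (z 0) * iteratedDeriv 4 f (z 0) / 6
      + p (z 0) * iteratedDeriv 5 f (z 0) / 6
      - sFun c (z 0) * iteratedDeriv 3 f (z 0)) * z 1 ^ 4 := fun z hz => by
  simp only [densityH₄, sFun, eval_add, eval_smul hz.2, eval_mul hz.2, eval_fn_one, eval_fn_two,
    eval_fn_three, eval_var_one, eval_var_two, iteratedDeriv_zero]
  push_cast
  ring

lemma represents_quasiInner₂ : Represents I (env c p f) quasiInner₂ fun y =>
    c (y 0) * (y 2 / y 1) + iteratedDeriv 1 c (y 0) * y 1 := fun z hz => by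
  simp only [quasiInner₂, eval_add, eval_mul hz.2, eval_fn_one, eval_var_one, eval_var_two, eval_upow,
    iteratedDeriv_zero, zpow_neg_literals]
  ring

lemma represents_quasiInner₀ : Represents I (env c p f) quasiInner₀ fun y =>
    y 2 ^ 3 / (360 * y 1 ^ 4) - 7 * y 2 * y 3 / (1920 * y 1 ^ 3) + y 4 / (1152 * y 1 ^ 2) :=
  fun z hz => by
  simp only [quasiInner₀, eval_add, eval_smul hz.2, eval_mul hz.2, eval_var_two,
    eval_var_three, eval_var_four, eval_upow, zpow_neg_literals]
  push_cast
  ring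

section
variable (hI : IsOpen I) (hF : ∀ i, ContDiffOn ℝ ∞ (env c p f i) I)
include hI hF

lemma represents_quasiInner₄ : Represents I (env c p f) quasiInner₄ (quasiBracket c p) :=
    fun z hz => by
  rw [quasiBracket, represents_quasiInner₀.totalD hI hF z hz]
  simp only [quasiInner₄, eval_add, eval_smul hz.2, eval_mul hz.2, eval_fn_one, eval_fn_two,
    eval_var_one, eval_var_two, eval_var_three, eval_var_four, eval_upow, iteratedDeriv_zero,
    zpow_neg_literals]
  push_cast
  ring

lemma Represents.ham {P : DiffPoly} {g : JetFun} (h : Represents I (env c p f) P g) :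
    Represents I (env c p f) (ham P) (totalD (euler g)) := (h.euler hI hF).totalD hI hF

lemma Represents.can₄ {P Q : DiffPoly} {g h : JetFun} (hP : Represents I (env c p f) P g)
    (hQ : Represents I (env c p f) Q h) : Represents I (env c p f) (can₄ P Q)
      (totalD (euler h) + (1 / 2 : ℝ) • evol (totalD (euler g)) (totalD (euler g))) :=
  (Represents.ham hI hF hQ).add ((((Represents.ham hI hF hP).evol hI hF
    (Represents.ham hI hF hP)).smul (1 / 2) (by norm_num)))

lemma represents_quasi₂ : Represents I (env c p f) quasi₂ fun z => 1 / 24 *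
    totalD (fun y : Jet => c (y 0) * (y 2 / y 1) + iteratedDeriv 1 c (y 0) * y 1) z :=
  (represents_quasiInner₂.totalD hI hF).smul (1 / 24) (by norm_num)

end

lemma IsEvenExpansion.expands {F : ℕ → ℝ → ℝ} {V : EpsFun} {T₁ T₂ : JetFun} {P₁ P₂ : DiffPoly}
    (h : IsEvenExpansion V (coord 0) T₁ T₂) (h₁ : Represents I F P₁ T₁)
    (h₂ : Represents I F P₂ T₂) : Expands I F V P₁ P₂ := fun ε z hz => by
  rw [h.eval6, h₁ z hz, h₂ z hz, coord]
  ring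

lemma isEvenExpansion_quasi (c p : ℝ → ℝ) : IsEvenExpansion (quasi c p) (coord 0)
    (fun z => 1 / 24 *
      totalD (fun y : Jet => c (y 0) * (y 2 / y 1) + iteratedDeriv 1 c (y 0) * y 1) z)
    (totalD (quasiBracket c p)) := isEvenExpansion_monomial _ _ _

lemma sameFunctional_of_eq {h₁ h₂ : JetFun} (h : h₁ = h₂) : SameFunctional I h₁ h₂ := by
  refine ⟨0, ⟨0, 0, contDiffOn_const, fun _ _ => rfl⟩, fun z _ => ?_⟩
  simp [h]

section
variable (hI : IsOpen I) (hF : ∀ i, ContDiffOn ℝ ∞ (env c p f i) I)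
include hI hF

lemma Represents.sameFunctional {P Q : DiffPoly} {h₁ h₂ : JetFun}
    (h : Represents I (env c p f) P (h₁ - h₂)) (H : same P (total Q) = true) :
    SameFunctional I h₁ h₂ := by
  refine ⟨eval (env c p f) Q, isLocal_eval hI hF Q, fun z hz => ?_⟩
  rw [(represents_eval Q).totalD hI hF z hz]
  exact h.congr H z hz

theorem sameFunctional_densityH {k : ℕ} (hk : k < 6) : SameFunctional I
    (PowerSeries.coeff k (densityH c p (sFun c) f))
    (PowerSeries.coeff k (applyFun f (canonical (densityK c p)))) := by
  have h1 : IsEvenExpansion (densityH c p (sFun c) f) _ _ _ := isEvenExpansion_monomial _ _ _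
  have h2 := (isEvenExpansion_canonical (fun z => 1 / 24 * c (z 0) * z 1 * Real.log (z 1))
    fun z => c (z 0) ^ 2 / 5760 * (z 2 ^ 3 / z 1 ^ 3) - p (z 0) / 4 * (z 2 ^ 2 / z 1)).applyFun f
  rw [← densityK_eq] at h2
  have hw := Represents.ham hI hF (represents_densityK₁ (I := I) (c := c) (p := p) (f := f))
  have hv := Represents.can₄ hI hF (represents_densityK₁ (I := I) (c := c) (p := p) (f := f))
    represents_densityK₃
  interval_cases k
  · exact sameFunctional_of_eq (by rw [h1.zero, h2.zero])
  · exact sameFunctional_of_eq (by rw [h1.one, h2.one])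
  · rw [h1.two, h2.two]
    refine Represents.sameFunctional hI hF (fun z hz => ?_) same_densityH₂
    rw [eval_add, eval_smul hz.2, eval_mul hz.2, ← represents_densityH₂ z hz, ← hw z hz,
      eval_fn_three]
    simp only [Pi.sub_apply]
    push_cast
    ring
  · exact sameFunctional_of_eq (by rw [h1.three, h2.three])
  · rw [h1.four, h2.four]
    refine Represents.sameFunctional hI hF (fun z hz => ?_) same_densityH₄
    rw [eval_add, eval_smul hz.2, eval_add, eval_smul hz.2, eval_mul hz.2, eval_mul hz.2,
      eval_mul hz.2, ← represents_densityH₄ z hz, ← hw z hz, ← hv z hz, eval_fn_three,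
      eval_fn_three]
    simp only [Pi.sub_apply]
    push_cast
    ring
  · exact sameFunctional_of_eq (by rw [h1.five, h2.five])

theorem canonical_neg_densityK {k : ℕ} (hk : k < 6) {z : Jet} (hz : z ∈ Dom I) :
    PowerSeries.coeff k (canonical (-densityK c p)) z = PowerSeries.coeff k (quasi c p) z := by
  have h1 := isEvenExpansion_canonical (-(fun z => 1 / 24 * c (z 0) * z 1 * Real.log (z 1)))
    (-fun z => c (z 0) ^ 2 / 5760 * (z 2 ^ 3 / z 1 ^ 3) - p (z 0) / 4 * (z 2 ^ 2 / z 1))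
  rw [← neg_odd3, ← densityK_eq] at h1
  have h2 := isEvenExpansion_quasi c p
  have hn {P : DiffPoly} {g : JetFun} (h : Represents I (env c p f) P g) :
      Represents I (env c p f) (smul (-1) P) (-g) := by
    simpa using h.smul (a := -1) (-1) (by norm_num)
  have h₁ := hn represents_densityK₁
  have h₃ := hn represents_densityK₃
  interval_cases k
  · rw [h1.zero, h2.zero]
  · rw [h1.one, h2.one]
  · rw [h1.two, h2.two]
    exact ((Represents.ham hI hF h₁).congr same_quasi₂ z hz).trans
      (represents_quasi₂ hI hF z hz).symm
  · rw [h1.three, h2.three]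
  · rw [h1.four, h2.four]
    exact ((Represents.can₄ hI hF h₁ h₃).congr same_quasi₄ z hz).trans
      ((represents_quasiInner₄ hI hF).totalD hI hF z hz).symm
  · rw [h1.five, h2.five]

lemma expands_canonical :
    Expands I (env c p f) (canonical (densityK c p)) (ham densityK₁) (can₄ densityK₁ densityK₃) :=
  (isEvenExpansion_canonical _ _).expands (Represents.ham hI hF represents_densityK₁)
    (Represents.can₄ hI hF represents_densityK₁ represents_densityK₃)

lemma expands_quasi : Expands I (env c p f) (quasi c p) quasi₂ quasi₄ :=
  (isEvenExpansion_quasi c p).expands (represents_quasi₂ hI hF)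
    ((represents_quasiInner₄ hI hF).totalD hI hF)

lemma eval6_hamField_densityH (ε : ℝ) {z : Jet} (hz : z ∈ Dom I) :
    eval6 (hamField (densityH c p (sFun c) f)) ε z =
      eval (env c p f) transport z + push (env c p f) (ham densityH₂) (ham densityH₄) ε z 0 := by
  have h1 : IsEvenExpansion (densityH c p (sFun c) f) _ _ _ := isEvenExpansion_monomial _ _ _
  have h0 : Represents I (env c p f) (fn 3 0) fun z => f (z 0) := fun z _ => by simp
  rw [h1.hamField.eval6, (Represents.ham hI hF h0).congr same_transport z hz,
    Represents.ham hI hF represents_densityH₂ z hz, Represents.ham hI hF represents_densityH₄ z hz]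
  simp only [push, Function.iterate_zero, id]
  ring

theorem solvesHamiltonian_substitute {Ω : Set (ℝ × ℝ)} (hΩ : IsOpen Ω) {v : ℝ → ℝ → ℝ → ℝ}
    (hv : IsMonotoneFamily I Ω v) (h : SolvesUnperturbed (iteratedDeriv 2 f) Ω v) :
    SolvesHamiltonian (densityH c p (sFun c) f) Ω (substitute (quasi c p) v) := by
  refine substitution_solves hI hF hΩ hv (expands_quasi hI hF) (A₁ := []) (A₂ := [])
    (a := fun _ z => iteratedDeriv 2 f (z 0) * z 1) (fun ε z hz => ?_)
    (fun ε z hz => eval6_hamField_densityH hI hF ε hz) (fun z hz => ?_) (fun z hz => ?_)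
    (fun x s hq => ?_)
  · simp [eval_transport, push, env]
  · have := eval_eq_of_same (F := env c p f) hz.2 same_solves₂
    rw [eval_add] at this
    simpa using this
  · have := eval_eq_of_same (F := env c p f) hz.2 same_solves₄
    -- The unperturbed equation has no corrections A₁, A₂, so the derivative along the zero field
    -- drops out.
    have h0 : eval (env c p f) (ev [] quasi₂) z = 0 := by
      have h1 : ∀ k, eval (env c p f) (total^[k] []) z = 0 := fun k => by
        have : total^[k] [] = [] := Function.iterate_fixed rfl k
        rw [this, eval_nil]
      rw [eval_ev hz.2]
      simp only [h1]
      exact deval_zero _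
    rw [eval_add, eval_add, eval_add] at this
    rw [h0, this]
    simp
  · simpa [jet] using h x s hq

theorem solvesUnperturbed_substitute {Ω : Set (ℝ × ℝ)} (hΩ : IsOpen Ω) {u : ℝ → ℝ → ℝ → ℝ}
    (hu : IsMonotoneFamily I Ω u) (h : SolvesHamiltonian (densityH c p (sFun c) f) Ω u) :
    SolvesUnperturbed (iteratedDeriv 2 f) Ω (substitute (canonical (densityK c p)) u) := by
  have h1 := substitution_solves hI hF hΩ hu (expands_canonical hI hF) (B₁ := []) (B₂ := [])
    (b := fun _ z => iteratedDeriv 2 f (z 0) * z 1)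
    (fun ε z hz => eval6_hamField_densityH hI hF ε hz) (fun ε z hz => ?_) (fun z hz => ?_)
    (fun z hz => ?_) h
  · intro x s hq
    simpa [jet] using h1 x s hq
  · simp [eval_transport, push, env]
  · have := eval_eq_of_same (F := env c p f) hz.2 same_solves₂'
    rw [eval_add] at this
    simpa using this
  · have := eval_eq_of_same (F := env c p f) hz.2 same_solves₄'
    have h0 : ev (ham densityK₁) [] = [] := rfl
    rw [eval_add, eval_add, eval_add] at this
    rw [this, h0]
    simp

end

end

end Quasitriviality

end

theorem mainTheorem1 (I : Set ℝ) (hI : IsOpen I) (c p : ℝ → ℝ)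
    (hc : ContDiffOn ℝ ∞ c I) (hp : ContDiffOn ℝ ∞ p I) :
    -- the canonical transformation generated by `K` turns every `H_f` into `∫ f(v) dx`
    (∀ f : ℝ → ℝ, ContDiffOn ℝ ∞ f I → ∀ k < 6,
      SameFunctional I
        (PowerSeries.coeff k (densityH c p (sFun c) f))
        (PowerSeries.coeff k (applyFun f (canonical (densityK c p))))) ∧
    -- the transformation generated by `-K` is given by the explicit rational substitution
    (∀ k < 6, ∀ z ∈ Dom I,
      PowerSeries.coeff k (canonical (-densityK c p)) z = PowerSeries.coeff k (quasi c p) z) ∧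
    -- the two substitutions are inverse to each other
    (∀ (w : ℝ → ℝ) (A : Set ℝ), IsOpen A → ContDiffOn ℝ ∞ w A →
      (∀ x ∈ A, w x ∈ I ∧ deriv w x ≠ 0) → ∀ x ∈ A,
        ((fun ε => eval6 (quasi c p) ε
            (jet (fun y => eval6 (canonical (densityK c p)) ε (jet w y)) x) - w x)
          =O[𝓝 0] fun ε : ℝ => ε ^ 6) ∧
        ((fun ε => eval6 (canonical (densityK c p)) ε
            (jet (fun y => eval6 (quasi c p) ε (jet w y)) x) - w x)
          =O[𝓝 0] fun ε : ℝ => ε ^ 6)) ∧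
    -- monotone solutions go to solutions modulo `O(ε⁶)`, simultaneously for all `f`
    (∀ f : ℝ → ℝ, ContDiffOn ℝ ∞ f I → ∀ Ω : Set (ℝ × ℝ), IsOpen Ω →
      -- exact solutions of the unperturbed equation
      (∀ v : ℝ → ℝ → ℝ, ContDiffOn ℝ ∞ (fun q : ℝ × ℝ => v q.1 q.2) Ω →
        (∀ x s, (x, s) ∈ Ω → v x s ∈ I ∧ deriv (fun y => v y s) x ≠ 0 ∧
          deriv (fun σ => v x σ) s + iteratedDeriv 2 f (v x s) * deriv (fun y => v y s) x = 0) →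
        SolvesHamiltonian (densityH c p (sFun c) f) Ω
          (substitute (quasi c p) (fun _ => v))) ∧
      -- solutions of the unperturbed equation modulo `O(ε⁶)`
      (∀ v : ℝ → ℝ → ℝ → ℝ, IsMonotoneFamily I Ω v →
        SolvesUnperturbed (iteratedDeriv 2 f) Ω v →
        SolvesHamiltonian (densityH c p (sFun c) f) Ω (substitute (quasi c p) v)) ∧
      -- and vice versa
      (∀ u : ℝ → ℝ → ℝ → ℝ, IsMonotoneFamily I Ω u →
        SolvesHamiltonian (densityH c p (sFun c) f) Ω u →
        SolvesUnperturbed (iteratedDeriv 2 f) Ω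
          (substitute (canonical (densityK c p)) u))) := by
  -- The explicit form of the substitution and the inverse property do not involve f; the zero
  -- function fills its place.
  have hF₀ := contDiffOn_env hc hp (contDiffOn_const (c := (0 : ℝ)))
  refine ⟨fun f hf k hk => sameFunctional_densityH hI (contDiffOn_env hc hp hf) hk,
    fun k hk z hz => canonical_neg_densityK hI hF₀ hk hz, fun w A hA hw hwA x hx => ?_,
    fun f hf Ω hΩ => ⟨fun v hv hsol => ?_,
      fun v hv => solvesHamiltonian_substitute hI (contDiffOn_env hc hp hf) hΩ hv,
      fun u hu => solvesUnperturbed_substitute hI (contDiffOn_env hc hp hf) hΩ hu⟩⟩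
  · have hD : ∀ x ∈ A, jet w x ∈ Dom I := fun x hx => by
      simpa [Dom, jet] using hwA x hx
    refine ⟨substitution_inverse hI hF₀ (expands_canonical hI hF₀) (expands_quasi hI hF₀)
      (fun z hz => ?_) (fun z hz => ?_) hA hw hD hx,
      substitution_inverse hI hF₀ (expands_quasi hI hF₀) (expands_canonical hI hF₀)
      (fun z hz => ?_) (fun z hz => ?_) hA hw hD hx⟩
    · rw [← DiffPoly.eval_add]
      exact DiffPoly.eval_eq_of_same hz.2 DiffPoly.same_inverse₂
    · rw [← DiffPoly.eval_add, ← DiffPoly.eval_add]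
      exact DiffPoly.eval_eq_of_same hz.2 DiffPoly.same_inverse₄
    · rw [add_comm, ← DiffPoly.eval_add]
      exact DiffPoly.eval_eq_of_same hz.2 DiffPoly.same_inverse₂
    · rw [← DiffPoly.eval_add, ← DiffPoly.eval_add]
      exact DiffPoly.eval_eq_of_same hz.2 DiffPoly.same_inverse₄'
  -- An exact solution is a family constant in ε, smooth on ℝ × Ω, whose residue is identically zero
  -- on Ω.
  · refine solvesHamiltonian_substitute hI (contDiffOn_env hc hp hf) hΩ
      ⟨⟨Set.univ ×ˢ Ω, isOpen_univ.prod hΩ, fun q hq => ⟨Set.mem_univ _, hq⟩, ?_⟩,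
        fun x s hq => ⟨(hsol x s hq).1, (hsol x s hq).2.1⟩⟩ fun x s hq => ?_
    · exact hv.comp contDiff_snd.contDiffOn fun r hr => hr.2
    · simp only [(hsol x s hq).2.2]
      exact Asymptotics.isBigO_zero _ _
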